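/- Let $k\ge 1$ and $d\ge 2$ be integers. For a field $K$ with absolute value $|\cdot|$ put $\|x\|=\max_i|x_i|$ on $K^{k+1}$, and let $\mathrm{dist}([x],[y])=\max_{i,j}|x_iy_j-x_jy_i|/(\|x\|\,\|y\|)$ be the chordal distance on $\mathbb{P}^k(K)$. Let $f:\mathbb{P}^k\to\mathbb{P}^k$ be an endomorphism of degree $d$ and let $F=(F_0,\dots,F_k)$ be a homogeneous polynomial lift of $f$ (forms of degree $d$ in $k+1$ variables without common zero other than the origin). Let $\|F\|$ be the maximum of the absolute values of the coefficients of $F$, let $\mathrm{Res}(F)$ be the Macaulay resultant, normalized by $\mathrm{Res}(X_0^d,\dots,X_k^d)=1$, and put \[M(F)=\frac{\|F\|^{(k+1)d^k}}{|\mathrm{Res}(F)|},\qquad u_F([x])=\tfrac1d\log\|F(x)\|-\log\|x\|,\qquad g_F=\sum_{j\ge0}d^{-j}\,u_F\circ f^j .\] There are constants $C_1,C_2\ge e$ and $C_3\ge1$, depending only on $d$ and $k$, such that the following holds. **(Local statement.)** Let $K$ be an algebraically closed field of characteristic $0$, complete with respect to a nontrivial absolute value, and let $F$ be a lift of a degree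 $d$ endomorphism $f$ of $\mathbb{P}^k_K$. Then $\mathrm{Res}(F)\ne0$, the series defining $g_F$ converges at every point, and: * if $K$ is archimedean, then for all $z,w\in\mathbb{P}^k(K)$ \[|g_F(z)-g_F(w)|\le C_3\bigl(C_1+\log^+\|F\|+\log^+M(F)\bigr)\,\mathrm{dist}(z,w)^{\alpha},\qquad \alpha=\frac{\log d}{C_2+\log\max\{2d,M(F)\}}>0;\] * if $K$ is non-archimedean, then for all $z,w\in\mathbb{P}^k(K)$ \[|g_F(z)-g_F(w)|\le C_3\bigl(\log^+\|F\|+\log^+M(F)\bigr)\,\mathrm{dist}(z,w)^{\alpha},\] where $\alpha=1$ if $M(F)=1$ and $\alpha=\log d/\log M(F)$ otherwise, and $\alpha>0$. **(Adelic statement.)** Let $\mathbb{K}$ be a number field, $|\cdot|_v$ a nontrivial absolute value on $\mathbb{K}$, $\mathbb{C}_v$ the completion of an algebraic closure of $\mathbb{K}_v$ (or any complete algebraically closed valued extension of $(\mathbb{K},|\cdot|_v)$), and $F$ a lift, with coefficients in $\mathbb{K}$, of a degree $d$ endomorphism of $\mathbb{P}^k$. Put $C_{1,v}=C_1$ if $v$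 is archimedean and $C_{1,v}=1$ otherwise. Then, with $M_v(F)=\|F\|_v^{(k+1)d^k}/|\mathrm{Res}(F)|_v$, for all $z,w\in\mathbb{P}^k(\mathbb{C}_v)$ \[|g_F(z)-g_F(w)|\le C_3\bigl(C_{1,v}+\log^+\|F\|_v+\log^+M_v(F)\bigr)\,\mathrm{dist}_v(z,w)^{\alpha_v},\] where $\alpha_v=\log d/\bigl(C_2+\log\max\{2d,M_v(F)\}\bigr)$ if $v$ is archimedean, and if $v$ is non-archimedean, $\alpha_v=1$ when $M_v(F)=1$ and $\alpha_v=\log d/(2\log M_v(F))$ otherwise. -/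

import Mathlib

open MvPolynomial Real
open scoped LinearAlgebra.Projectivization

noncomputable section

namespace GreenHolder

/-! ### The Macaulay resultant of `k + 1` forms of degree `d` in `k + 1` variables -/

/-- Exponents of the monomials of degree `n` in the `k + 1` variables `X_0, …, X_k`. -/
abbrev Mon (k n : ℕ) : Type :=
  {α : Fin (k + 1) →₀ ℕ // α ∈ Finset.finsuppAntidiag (Finset.univ : Finset (Fin (k + 1))) n}

/-- The full Macaulay matrix in degree `t = k (d - 1) + d = (k + 1) (d - 1) + 1`, the critical
degree of `k + 1` forms of degree `d`. Its columns are the monomials `X ^ α` of degree `t`; the row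
`(i, β)`, with `|β| = t - d = k (d - 1)`, lists the coefficients of the form `X ^ β * F_i`. -/
def macaulayMatrix {R : Type*} [CommRing R] (k d : ℕ)
    (F : Fin (k + 1) → MvPolynomial (Fin (k + 1)) R) :
    Matrix (Fin (k + 1) × Mon k (k * (d - 1))) (Mon k (k * (d - 1) + d)) R :=
  fun p α => (monomial (p.2 : Fin (k + 1) →₀ ℕ) 1 * F p.1).coeff α

/-- The ring `ℤ[c]` of polynomials in the indeterminate coefficients `c_{i, α}`. -/
abbrev CoeffRing (k : ℕ) : Type :=
  MvPolynomial (Fin (k + 1) × (Fin (k + 1) →₀ ℕ)) ℤ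

/-- The generic form `∑_{|α| = d} c_{i, α} X ^ α`. -/
def genericForm (k d : ℕ) (i : Fin (k + 1)) : MvPolynomial (Fin (k + 1)) (CoeffRing k) :=
  ∑ α : Mon k d, monomial (α : Fin (k + 1) →₀ ℕ) (X (i, (α : Fin (k + 1) →₀ ℕ)))

/-- A polynomial in the indeterminate coefficients, evaluated at the coefficients of `F`. -/
def evalCoeffs {R : Type*} [CommRing R] {k : ℕ}
    (F : Fin (k + 1) → MvPolynomial (Fin (k + 1)) R) (P : CoeffRing k) : R :=
  aeval (fun p : Fin (k + 1) × (Fin (k + 1) →₀ ℕ) => (F p.1).coeff p.2) P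

/-- The greatest common divisor in `ℤ[c]` of all the maximal minors of the Macaulay matrix of the
generic forms. It is determined up to sign; a choice of rows with a repetition contributes `0`. -/
def minorsGcd (k d : ℕ) : CoeffRing k :=
  letI : NormalizedGCDMonoid (CoeffRing k) := Nonempty.some inferInstance
  (Finset.univ : Finset (Mon k (k * (d - 1) + d) → Fin (k + 1) × Mon k (k * (d - 1)))).gcd
    fun e => ((macaulayMatrix k d (genericForm k d)).submatrix e id).det

/-- The Macaulay resultant in `ℤ[c]`: the greatest common divisor of the maximal minors of the
Macaulay matrix of the generic forms, with the sign for which `Res (X_0 ^ d, …, X_k ^ d) = 1`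
(the greatest common divisor takes the value `1` or `-1` there, because one of the minors does). -/
def universalResultant (k d : ℕ) : CoeffRing k :=
  C (evalCoeffs (fun i => (X i : MvPolynomial (Fin (k + 1)) ℤ) ^ d) (minorsGcd k d)) * minorsGcd k d

/-- The Macaulay resultant `Res (F)` of `F = (F_0, …, F_k)`. -/
def resultant {R : Type*} [CommRing R] {k : ℕ} (d : ℕ)
    (F : Fin (k + 1) → MvPolynomial (Fin (k + 1)) R) : R :=
  evalCoeffs F (universalResultant k d)

/-! ### Size of a lift -/

/-- `‖F‖`, the maximum of `|a|` over the coefficients `a` of `F`, with respect to `|·| = w`. -/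
def coeffNorm {R : Type*} [CommRing R] {k : ℕ} (w : R → ℝ) (d : ℕ)
    (F : Fin (k + 1) → MvPolynomial (Fin (k + 1)) R) : ℝ :=
  ⨆ p : Fin (k + 1) × Mon k d, w ((F p.1).coeff p.2)

/-- The quantity `‖F‖ ^ ((k + 1) d ^ k) / |Res (F)|`, with respect to `|·| = w`. -/
def resRatio {R : Type*} [CommRing R] {k : ℕ} (w : R → ℝ) (d : ℕ)
    (F : Fin (k + 1) → MvPolynomial (Fin (k + 1)) R) : ℝ :=
  coeffNorm w d F ^ ((k + 1) * d ^ k) / w (resultant d F)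

/-- The exponent `log d / (C + log max {2d, M})`. -/
def archExponent (d : ℕ) (C M : ℝ) : ℝ :=
  log d / (C + log (max (2 * d) M))

/-- The exponent `1` if `M = 1` and `log d / (c log M)` otherwise. -/
def nonarchExponent (d : ℕ) (c M : ℝ) : ℝ :=
  open scoped Classical in if M = 1 then 1 else log d / (c * log M)

/-! ### Endomorphisms of projective space, chordal distance and Green function -/

/-- `x ↦ F (x)` on `K ^ (k + 1)`. -/
def evalMap {K : Type*} [Field K] {k : ℕ} (F : Fin (k + 1) → MvPolynomial (Fin (k + 1)) K)
    (x : Fin (k + 1) → K) : Fin (k + 1) → K :=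
  fun i => eval x (F i)

/-- `F` is a homogeneous polynomial lift of the degree `d` endomorphism `f` of `ℙ^k` over the
algebraically closed field `K`: its components are forms of degree `d` without common zero outside
the origin, and `f [x] = [F (x)]`. -/
structure IsLift {K : Type*} [Field K] {k : ℕ} (d : ℕ)
    (F : Fin (k + 1) → MvPolynomial (Fin (k + 1)) K)
    (f : ℙ K (Fin (k + 1) → K) → ℙ K (Fin (k + 1) → K)) : Prop where
  homogeneous : ∀ i, (F i).IsHomogeneous d
  map_mk : ∀ (x : Fin (k + 1) → K) (hx : x ≠ 0),
    ∃ h : evalMap F x ≠ 0, f (Projectivization.mk K x hx) = Projectivization.mk K (evalMap F x) h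

/-- The chordal distance `max_{i, j} |x_i y_j - x_j y_i| / (‖x‖ ‖y‖)`, where `x` and `y` are
homogeneous coordinates of the points and `‖·‖` is the maximum norm;
see `chordalDist_mk` for the independence of the coordinates. -/
def chordalDist {K : Type*} [NormedField K] {k : ℕ} (z w : ℙ K (Fin (k + 1) → K)) : ℝ :=
  (⨆ p : Fin (k + 1) × Fin (k + 1), ‖z.rep p.1 * w.rep p.2 - z.rep p.2 * w.rep p.1‖) /
    (‖z.rep‖ * ‖w.rep‖)

/-- `u_F (z) = d⁻¹ log ‖F (x)‖ - log ‖x‖`, where `x` are homogeneous coordinates of `z`;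
see `potential_mk` for the independence of the coordinates. -/
def potential {K : Type*} [NormedField K] {k : ℕ} (d : ℕ)
    (F : Fin (k + 1) → MvPolynomial (Fin (k + 1)) K) (z : ℙ K (Fin (k + 1) → K)) : ℝ :=
  1 / d * log ‖evalMap F z.rep‖ - log ‖z.rep‖

/-- The Green function `g_F = ∑_{j ≥ 0} d ^ (-j) u_F ∘ f^j`. -/
def green {K : Type*} [NormedField K] {k : ℕ} (d : ℕ)
    (F : Fin (k + 1) → MvPolynomial (Fin (k + 1)) K)
    (f : ℙ K (Fin (k + 1) → K) → ℙ K (Fin (k + 1) → K)) (z : ℙ K (Fin (k + 1) → K)) : ℝ :=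
  ∑' j : ℕ, potential d F (f^[j] z) / (d : ℝ) ^ j

theorem chordalDist_mk {K : Type*} [NormedField K] {k : ℕ} (x y : Fin (k + 1) → K)
    (hx : x ≠ 0) (hy : y ≠ 0) :
    chordalDist (Projectivization.mk K x hx) (Projectivization.mk K y hy) =
      (⨆ p : Fin (k + 1) × Fin (k + 1), ‖x p.1 * y p.2 - x p.2 * y p.1‖) / (‖x‖ * ‖y‖) := by
  obtain ⟨a, ha⟩ := Projectivization.exists_smul_eq_mk_rep K x hx
  obtain ⟨b, hb⟩ := Projectivization.exists_smul_eq_mk_rep K y hy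
  have ha0 : ‖(a : K)‖ ≠ 0 := norm_ne_zero_iff.2 a.ne_zero
  have hb0 : ‖(b : K)‖ ≠ 0 := norm_ne_zero_iff.2 b.ne_zero
  unfold chordalDist
  rw [← ha, ← hb]
  simp only [Units.smul_def, Pi.smul_apply, smul_eq_mul, norm_smul]
  have h : ∀ p : Fin (k + 1) × Fin (k + 1),
      ‖(a : K) * x p.1 * ((b : K) * y p.2) - (a : K) * x p.2 * ((b : K) * y p.1)‖ =
        (‖(a : K)‖ * ‖(b : K)‖) * ‖x p.1 * y p.2 - x p.2 * y p.1‖ := by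
    intro p
    rw [← norm_mul, ← norm_mul]
    congr 1
    ring
  simp only [h]
  rw [← Real.mul_iSup_of_nonneg (by positivity)]
  have hx0 : ‖x‖ ≠ 0 := norm_ne_zero_iff.2 hx
  have hy0 : ‖y‖ ≠ 0 := norm_ne_zero_iff.2 hy
  field_simp

theorem potential_mk {K : Type*} [NormedField K] {k d : ℕ} (hd : d ≠ 0)
    {F : Fin (k + 1) → MvPolynomial (Fin (k + 1)) K}
    {f : ℙ K (Fin (k + 1) → K) → ℙ K (Fin (k + 1) → K)} (hF : IsLift d F f)
    (x : Fin (k + 1) → K) (hx : x ≠ 0) :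
    potential d F (Projectivization.mk K x hx) = 1 / d * log ‖evalMap F x‖ - log ‖x‖ := by
  obtain ⟨a, ha⟩ := Projectivization.exists_smul_eq_mk_rep K x hx
  obtain ⟨h, -⟩ := hF.map_mk x hx
  have ha0 : ‖(a : K)‖ ≠ 0 := norm_ne_zero_iff.2 a.ne_zero
  have hx0 : ‖x‖ ≠ 0 := norm_ne_zero_iff.2 hx
  have hF0 : ‖evalMap F x‖ ≠ 0 := norm_ne_zero_iff.2 h
  have hd0 : (d : ℝ) ≠ 0 := Nat.cast_ne_zero.2 hd
  have hs : evalMap F ((a : K) • x) = (a : K) ^ d • evalMap F x := by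
    funext i
    simp only [evalMap, Pi.smul_apply, smul_eq_mul]
    rw [eval_eq', eval_eq', Finset.mul_sum]
    refine Finset.sum_congr rfl fun m hm => ?_
    have hm' : m.degree = d := by
      rw [Finsupp.degree_eq_weight_one]
      exact hF.homogeneous i (mem_support_iff.1 hm)
    have hs : ∑ j, m j = d := by rw [← hm', Finsupp.degree_eq_sum]
    have hp : ∀ j, ((a : K) • x) j = (a : K) * x j := fun j => rfl
    simp only [hp, mul_pow, Finset.prod_mul_distrib]
    rw [Finset.prod_pow_eq_pow_sum, hs]
    ring
  unfold potential
  rw [← ha, Units.smul_def, hs, norm_smul, norm_smul, norm_pow,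
    Real.log_mul (pow_ne_zero _ ha0) hF0, Real.log_mul ha0 hx0, Real.log_pow]
  field_simp
  ring

end GreenHolder

end

open GreenHolder

universe u v

noncomputable section

namespace GreenHolder

/-! ### Values of forms with given coefficients -/

/-! The proof rests on one arithmetic inequality and one dynamical estimate. The inequality is a
lower bound `‖F(x)‖ ≥ a ‖x‖^d` with `a = ‖F‖ / (B M(F))`, where `B` depends only on `k` and `d` and
can be taken to be `1` over ultrametric fields (`exists_norm_resultant_le`, `exists_lift_bounds`).
Together with the trivial upper and Lipschitz bounds by multiples of `‖F‖`, it makes `f` Lipschitz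
with constant `O(M)` and `u_F` of oscillation `O(1 + log⁺ M)`. Moreover, at small distances `u_F` is
Lipschitz in general and locally constant in the ultrametric case (`step_of_normed`,
`step_of_ultrametric`). The Hölder bound follows by cutting the series for `g_F` at the time when
the orbits may have separated (`abs_tsum_sub_tsum_le`); the exponent `α` is the solution of `Λ^α =
d` for a Lipschitz constant `Λ` of `f`.

The lower bound comes from an identity over `ℤ`: in each chart `x_j = 1` the universal resultant is
a combination of the generic forms. This is membership in the inertia ideal, the kernel of the map
making the forms vanish at a generic point. Evaluating at coefficients and coordinates normalized to
size at most `1` bounds the multipliers uniformly, and by `1` in the ultrametric case because they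
have integer coefficients. Homogeneity of degree `(k+1)d^k` undoes the normalization.

Since the resultant is defined as a gcd of Macaulay minors, it must be identified with a generator
of this prime ideal (`minorsGcd_properties`). The ideal is principal by Gauss's lemma, because it
contains no nonzero polynomial in all coefficients but one (`exists_inertiaIdeal_eq_span`). All
minors lie in it, so its generator divides the gcd. In the coefficients of each single form, a
suitable minor has degree at most `d^k` (`exists_macaulay_minor`), while the generator has degree at
least `d^k`, by counting zeros of a pencil of split forms (`pow_le_of_span`). Hence the cofactor is
constant, and it is a unit because one minor equals `1` at the power forms. Finally the resultant
does not vanish on a lift: the Nullstellensatz gives a nonzero Macaulay minor in some degree, and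
that minor is a multiple of the generator (`evalCoeffs_ne_zero_of_le_span`). -/

/-- The value at `x` of the `i`-th form of degree `d` with coefficients `c`. -/
def formValue {R : Type*} [CommSemiring R] {k : ℕ} (d : ℕ)
    (c : Fin (k + 1) × (Fin (k + 1) →₀ ℕ) → R) (x : Fin (k + 1) → R) (i : Fin (k + 1)) : R :=
  ∑ α : Mon k d, c (i, (α : Fin (k + 1) →₀ ℕ)) * ∏ j, x j ^ (α : Fin (k + 1) →₀ ℕ) j

theorem ringHom_eq_aeval {σ S : Type*} [CommRing S] (f : MvPolynomial σ ℤ →+* S)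
    (a : MvPolynomial σ ℤ) : f a = aeval (fun p => f (X p)) a := by
  induction a using MvPolynomial.induction_on with
  | C n => simp
  | add p q hp hq => rw [map_add, map_add, hp, hq]
  | mul_X p i hp => rw [map_mul, map_mul, hp, aeval_X]

theorem mem_mon {k n : ℕ} {α : Fin (k + 1) →₀ ℕ} :
    α ∈ Finset.finsuppAntidiag (Finset.univ : Finset (Fin (k + 1))) n ↔ ∑ j, α j = n := by
  simp [Finset.mem_finsuppAntidiag]

theorem Mon.sum_eq {k n : ℕ} (α : Mon k n) : ∑ j, (α : Fin (k + 1) →₀ ℕ) j = n :=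
  mem_mon.1 α.2

theorem single_mem_mon {k : ℕ} (n : ℕ) (j : Fin (k + 1)) :
    Finsupp.single j n ∈ Finset.finsuppAntidiag (Finset.univ : Finset (Fin (k + 1))) n := by
  simp [Finsupp.single_apply]

theorem map_formValue {R S : Type*} [CommSemiring R] [CommSemiring S] {k d : ℕ} (f : R →+* S)
    (c : Fin (k + 1) × (Fin (k + 1) →₀ ℕ) → R) (x : Fin (k + 1) → R) (i : Fin (k + 1)) :
    f (formValue d c x i) = formValue d (fun p => f (c p)) (fun j => f (x j)) i := by
  simp [formValue, map_sum, map_mul, map_prod, map_pow]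

theorem formValue_smul {R : Type*} [CommSemiring R] {k d : ℕ}
    (c : Fin (k + 1) × (Fin (k + 1) →₀ ℕ) → R) (a : R) (x : Fin (k + 1) → R) (i : Fin (k + 1)) :
    formValue d c (a • x) i = a ^ d * formValue d c x i := by
  simp only [formValue, Pi.smul_apply, smul_eq_mul, mul_pow, Finset.prod_mul_distrib,
    Finset.prod_pow_eq_pow_sum, Mon.sum_eq, Finset.mul_sum]
  exact Finset.sum_congr rfl fun _ _ => by ring

theorem isHomogeneous_eq_sum {R : Type*} [CommSemiring R] {k d : ℕ}
    {F : MvPolynomial (Fin (k + 1)) R} (hF : F.IsHomogeneous d) :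
    F = ∑ α : Mon k d, monomial (α : Fin (k + 1) →₀ ℕ) (F.coeff α) := by
  classical
  ext m
  rw [coeff_sum]
  simp only [coeff_monomial]
  by_cases hm : m ∈ Finset.finsuppAntidiag (Finset.univ : Finset (Fin (k + 1))) d
  · rw [Finset.sum_eq_single ⟨m, hm⟩]
    · simp
    · intro b _ hb
      rw [if_neg]
      exact fun h => hb (Subtype.ext h)
    · simp
  · rw [Finset.sum_eq_zero]
    · by_contra h
      apply hm
      have := hF h
      rw [mem_mon, ← this, ← Finsupp.degree_eq_sum, Finsupp.degree_eq_weight_one]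
      rfl
    · intro b _
      rw [if_neg]
      rintro rfl
      exact hm b.2

theorem eval_eq_formValue {R : Type*} [CommRing R] {k d : ℕ}
    {F : Fin (k + 1) → MvPolynomial (Fin (k + 1)) R} (hF : ∀ i, (F i).IsHomogeneous d)
    (x : Fin (k + 1) → R) (i : Fin (k + 1)) :
    eval x (F i) = formValue d (fun p => (F p.1).coeff p.2) x i := by
  conv_lhs => rw [isHomogeneous_eq_sum (hF i)]
  simp only [map_sum, eval_monomial, formValue]
  refine Finset.sum_congr rfl fun α _ => ?_
  rw [Finsupp.prod_fintype _ _ (by simp)]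

/-! ### The ideal of the resultant -/

/-- The generic point of the chart `x_j = 1`. -/
def chartPoint (k : ℕ) (j : Fin (k + 1)) :
    Fin (k + 1) → MvPolynomial (Fin (k + 1)) (CoeffRing k) :=
  Function.update X j 1

/-- The generic forms, dehomogenized by `x_j = 1`. -/
def chartForm (k d : ℕ) (j i : Fin (k + 1)) : MvPolynomial (Fin (k + 1)) (CoeffRing k) :=
  formValue d (fun p => C (X p)) (chartPoint k j) i

/-- The homomorphism that modifies the coefficients of `X_j ^ d` in the generic forms so that
they vanish at the generic point of the chart `x_j = 1`. -/
def chartHom (k d : ℕ) (j : Fin (k + 1)) :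
    CoeffRing k →ₐ[ℤ] MvPolynomial (Fin (k + 1)) (CoeffRing k) :=
  aeval fun p => if p.2 = Finsupp.single j d then C (X p) - chartForm k d j p.1 else C (X p)

/-- The prime ideal of the resultant: the kernel of `chartHom`, in the chart `x_0 = 1`. -/
def inertiaIdeal (k d : ℕ) : Ideal (CoeffRing k) :=
  RingHom.ker (chartHom k d 0)

instance (k d : ℕ) : (inertiaIdeal k d).IsPrime :=
  RingHom.ker_isPrime _

theorem chartPoint_prod_single (k d : ℕ) (j : Fin (k + 1)) :
    ∏ l, chartPoint k j l ^ (Finsupp.single j d) l = 1 := by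
  refine Finset.prod_eq_one fun l _ => ?_
  by_cases h : l = j
  · subst h; simp [chartPoint]
  · simp [Finsupp.single_eq_of_ne h]

/-- The monomial `X_j ^ d` equals `1` at the chart point, so lowering its coefficient by the value
of the form makes that value zero. -/
theorem formValue_chartHom (k d : ℕ) (j i : Fin (k + 1)) :
    formValue d (fun p => chartHom k d j (X p)) (chartPoint k j) i = 0 := by
  classical
  have h : ∀ α : Mon k d, chartHom k d j (X (i, (α : Fin (k + 1) →₀ ℕ))) *
      ∏ l, chartPoint k j l ^ (α : Fin (k + 1) →₀ ℕ) l =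
      C (X (i, (α : Fin (k + 1) →₀ ℕ))) * ∏ l, chartPoint k j l ^ (α : Fin (k + 1) →₀ ℕ) l -
      if α = ⟨Finsupp.single j d, single_mem_mon d j⟩ then chartForm k d j i else 0 := by
    intro α
    simp only [chartHom, aeval_X]
    by_cases hα : (α : Fin (k + 1) →₀ ℕ) = Finsupp.single j d
    · rw [if_pos hα, if_pos (Subtype.ext hα), hα, chartPoint_prod_single]
      ring
    · rw [if_neg hα, if_neg (fun h => hα (congrArg Subtype.val h))]
      ring
  unfold formValue
  rw [Finset.sum_congr rfl fun α _ => h α, Finset.sum_sub_distrib]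
  simp [chartForm, formValue]

/-- Modulo the dehomogenized forms, `chartHom` leaves every coefficient variable unchanged. Hence
its kernel lies in the ideal they generate, which is the source of the identity behind the lower
bound. -/
theorem sub_chartHom_mem (k d : ℕ) (j : Fin (k + 1)) (a : CoeffRing k) :
    C a - chartHom k d j a ∈ Ideal.span (Set.range (chartForm k d j)) := by
  set I := Ideal.span (Set.range (chartForm k d j))
  rw [← Ideal.Quotient.eq]
  have hX : ∀ p, Ideal.Quotient.mk I (C (X p)) = Ideal.Quotient.mk I (chartHom k d j (X p)) := by
    intro p
    rw [Ideal.Quotient.eq]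
    simp only [chartHom, aeval_X]
    split_ifs
    · rw [sub_sub_cancel]
      exact Ideal.subset_span ⟨p.1, rfl⟩
    · simp
  refine (ringHom_eq_aeval (S := MvPolynomial (Fin (k + 1)) (CoeffRing k) ⧸ I) ((Ideal.Quotient.mk I).comp C) a).trans
    (Eq.trans ?_ (ringHom_eq_aeval (S := MvPolynomial (Fin (k + 1)) (CoeffRing k) ⧸ I) ((Ideal.Quotient.mk I).comp
      (chartHom k d j : CoeffRing k →+* MvPolynomial (Fin (k + 1)) (CoeffRing k))) a).symm)
  exact congrArg (fun c => aeval c a) (funext hX)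

/-- An element of the kernel of `chartHom` is a combination of the dehomogenized forms. -/
theorem exists_eq_sum_of_chartHom_eq_zero {k d : ℕ} {j : Fin (k + 1)} {a : CoeffRing k}
    (ha : chartHom k d j a = 0) :
    ∃ A : Fin (k + 1) → MvPolynomial (Fin (k + 1)) (CoeffRing k),
      C a = ∑ i, A i * chartForm k d j i := by
  have h := sub_chartHom_mem k d j a
  rw [ha, sub_zero] at h
  obtain ⟨A, hA⟩ := (Ideal.mem_span_range_iff_exists_fun).1 h
  exact ⟨A, hA.symm⟩

theorem eval₂Hom_chartForm {K : Type*} [CommRing K] {k d : ℕ} {j : Fin (k + 1)}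
    (c : Fin (k + 1) × (Fin (k + 1) →₀ ℕ) → K) (x : Fin (k + 1) → K) (hx : x j = 1)
    (i : Fin (k + 1)) :
    eval₂Hom (aeval c : CoeffRing k →ₐ[ℤ] K).toRingHom x (chartForm k d j i) =
      formValue d c x i := by
  rw [chartForm, map_formValue]
  congr 1
  · ext p; simp
  · ext l
    by_cases h : l = j
    · subst h; simp [chartPoint, hx]
    · simp [chartPoint, Function.update_of_ne h]

theorem aeval_eq_zero_of_chartHom {K : Type*} [Field K] {k d : ℕ} {j : Fin (k + 1)}
    {a : CoeffRing k} (ha : chartHom k d j a = 0)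
    (c : Fin (k + 1) × (Fin (k + 1) →₀ ℕ) → K) (x : Fin (k + 1) → K) (hx : x j ≠ 0)
    (h0 : ∀ i, formValue d c x i = 0) : aeval c a = 0 := by
  obtain ⟨A, hA⟩ := exists_eq_sum_of_chartHom_eq_zero ha
  have hx' : ((x j)⁻¹ • x) j = 1 := by simp [hx]
  have := congrArg (eval₂Hom (aeval c : CoeffRing k →ₐ[ℤ] K).toRingHom ((x j)⁻¹ • x)) hA
  rw [map_sum] at this
  simp only [map_mul, eval₂Hom_chartForm c _ hx', formValue_smul, h0, mul_zero,
    Finset.sum_const_zero] at this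
  simpa using this

/-- The kernel does not depend on the chart: the generic point of chart `l` has nonzero `j`-th
coordinate over the fraction field, so it is also a common zero visible from chart `j`. -/
theorem chartHom_eq_zero_of_chartHom {k d : ℕ} {j : Fin (k + 1)} {a : CoeffRing k}
    (ha : chartHom k d j a = 0) (l : Fin (k + 1)) : chartHom k d l a = 0 := by
  let L := FractionRing (MvPolynomial (Fin (k + 1)) (CoeffRing k))
  have hinj : Function.Injective (algebraMap (MvPolynomial (Fin (k + 1)) (CoeffRing k)) L) :=
    IsFractionRing.injective _ _
  apply hinj
  rw [map_zero]
  have h := aeval_eq_zero_of_chartHom ha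
    (fun p => algebraMap _ L (chartHom k d l (X p))) (fun m => algebraMap _ L (chartPoint k l m))
    ?_ ?_
  · rw [← h]
    exact ringHom_eq_aeval ((algebraMap (MvPolynomial (Fin (k + 1)) (CoeffRing k)) L).comp
      (chartHom k d l : CoeffRing k →+* MvPolynomial (Fin (k + 1)) (CoeffRing k))) a
  · rw [Ne, map_eq_zero_iff _ hinj]
    by_cases h : j = l
    · subst h; simp [chartPoint]
    · simp [chartPoint, Function.update_of_ne h]
  · intro i
    rw [← map_formValue, formValue_chartHom, map_zero]

theorem mem_inertiaIdeal {k d : ℕ} {a : CoeffRing k} (j : Fin (k + 1)) :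
    a ∈ inertiaIdeal k d ↔ chartHom k d j a = 0 :=
  ⟨fun h => chartHom_eq_zero_of_chartHom h j, fun h => chartHom_eq_zero_of_chartHom h 0⟩

/-- An element of the ideal of the resultant vanishes on forms with a nontrivial common zero. -/
theorem aeval_eq_zero_of_mem_inertiaIdeal {K : Type*} [Field K] {k d : ℕ}
    {a : CoeffRing k} (ha : a ∈ inertiaIdeal k d)
    (c : Fin (k + 1) × (Fin (k + 1) →₀ ℕ) → K) (x : Fin (k + 1) → K) (hx : x ≠ 0)
    (h0 : ∀ i, formValue d c x i = 0) : aeval c a = 0 := by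
  obtain ⟨j, hj⟩ := Function.ne_iff.1 hx
  exact aeval_eq_zero_of_chartHom ((mem_inertiaIdeal j).1 ha) c x hj h0

/-! ### Macaulay matrices -/

/-- The maximal minors of the Macaulay matrix of degree `n + d` of the forms with coefficients
`c`. -/
def genMacaulay {R : Type*} [CommRing R] (k d n : ℕ)
    (F : Fin (k + 1) → MvPolynomial (Fin (k + 1)) R) :
    Matrix (Fin (k + 1) × Mon k n) (Mon k (n + d)) R :=
  fun p α => (monomial (p.2 : Fin (k + 1) →₀ ℕ) 1 * F p.1).coeff α

theorem coeff_genericForm (k d : ℕ) (i : Fin (k + 1)) (α : Fin (k + 1) →₀ ℕ)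
    (hα : ∑ j, α j = d) : (genericForm k d i).coeff α = X (i, α) := by
  classical
  rw [genericForm, coeff_sum, Finset.sum_eq_single ⟨α, mem_mon.2 hα⟩]
  · simp
  · intro b _ hb
    rw [coeff_monomial, if_neg fun h => hb (Subtype.ext h)]
  · simp

theorem genericForm_isHomogeneous (k d : ℕ) (i : Fin (k + 1)) :
    (genericForm k d i).IsHomogeneous d := by
  refine IsHomogeneous.sum _ _ _ fun α _ => isHomogeneous_monomial _ ?_
  rw [Finsupp.degree_eq_sum, α.sum_eq]

theorem map_genericForm {R : Type*} [CommRing R] {k d : ℕ}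
    {F : Fin (k + 1) → MvPolynomial (Fin (k + 1)) R} (hF : ∀ i, (F i).IsHomogeneous d)
    (i : Fin (k + 1)) :
    map (aeval (fun p : Fin (k + 1) × (Fin (k + 1) →₀ ℕ) => (F p.1).coeff p.2) :
      CoeffRing k →ₐ[ℤ] R).toRingHom (genericForm k d i) = F i := by
  conv_rhs => rw [isHomogeneous_eq_sum (hF i)]
  simp [genericForm, map_sum, map_monomial]

theorem map_macaulay {R S : Type*} [CommRing R] [CommRing S] {k d n : ℕ} (f : R →+* S)
    (F : Fin (k + 1) → MvPolynomial (Fin (k + 1)) R) :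
    (genMacaulay k d n F).map f = genMacaulay k d n fun i => map f (F i) := by
  ext p α
  simp only [genMacaulay, Matrix.map_apply, ← coeff_map, map_mul, map_monomial, map_one]

/-- Each row of the Macaulay matrix lists the coefficients of a multiple of a form. -/
theorem genMacaulay_mulVec {R : Type*} [CommRing R] {k d n : ℕ}
    {F : Fin (k + 1) → MvPolynomial (Fin (k + 1)) R} (hF : ∀ i, (F i).IsHomogeneous d)
    (x : Fin (k + 1) → R) (p : Fin (k + 1) × Mon k n) :
    ∑ α, genMacaulay k d n F p α * ∏ j, x j ^ (α : Fin (k + 1) →₀ ℕ) j =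
      (∏ j, x j ^ (p.2 : Fin (k + 1) →₀ ℕ) j) * eval x (F p.1) := by
  have hh : (monomial (p.2 : Fin (k + 1) →₀ ℕ) (1 : R) * F p.1).IsHomogeneous (n + d) := by
    refine IsHomogeneous.mul (isHomogeneous_monomial _ ?_) (hF _)
    rw [Finsupp.degree_eq_sum, p.2.sum_eq]
  have := congrArg (eval x) (isHomogeneous_eq_sum hh)
  simp only [map_sum, map_mul, eval_monomial, one_mul] at this
  rw [Finsupp.prod_fintype _ _ (by simp)] at this
  rw [this]
  refine Finset.sum_congr rfl fun α _ => ?_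
  rw [Finsupp.prod_fintype _ _ (by simp)]
  rfl

/-- Once the forms vanish at the chart point, the vector of its monomials is killed by every row `X
^ β * F_i`. It is nonzero, its entry at `X_0 ^ (n + d)` being `1`, so every maximal minor vanishes,
in every degree `n + d`. -/
theorem det_macaulay_mem {k d n : ℕ} (e : Mon k (n + d) → Fin (k + 1) × Mon k n) :
    ((genMacaulay k d n (genericForm k d)).submatrix e id).det ∈ inertiaIdeal k d := by
  rw [mem_inertiaIdeal 0]
  set Φ : CoeffRing k →+* MvPolynomial (Fin (k + 1)) (CoeffRing k) :=
    (chartHom k d 0 : CoeffRing k →+* MvPolynomial (Fin (k + 1)) (CoeffRing k)) with hΦ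
  change Φ _ = 0
  rw [RingHom.map_det, RingHom.mapMatrix_apply, ← Matrix.submatrix_map, map_macaulay]
  rw [← Matrix.exists_mulVec_eq_zero_iff]
  refine ⟨fun α => ∏ j, chartPoint k 0 j ^ (α : Fin (k + 1) →₀ ℕ) j, ?_, ?_⟩
  · intro h
    have := congrFun h ⟨Finsupp.single 0 (n + d), single_mem_mon _ _⟩
    simp only [chartPoint_prod_single] at this
    exact one_ne_zero this
  · ext1 r
    simp only [Matrix.mulVec, dotProduct, Matrix.submatrix_apply, id, Pi.zero_apply]
    rw [genMacaulay_mulVec fun i => (genericForm_isHomogeneous k d i).map Φ]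
    rw [eval_eq_formValue fun i => (genericForm_isHomogeneous k d i).map Φ]
    have : formValue d (fun p => coeff p.2 (map Φ (genericForm k d p.1)))
        (chartPoint k 0) (e r).1 = formValue d (fun p => chartHom k d 0 (X p))
        (chartPoint k 0) (e r).1 := by
      refine Finset.sum_congr rfl fun α _ => ?_
      simp only []
      rw [coeff_map, coeff_genericForm _ _ _ _ α.sum_eq]
      rfl
    rw [this, formValue_chartHom, mul_zero]

/-! ### The ideal of the resultant is principal -/

theorem intHom_ext {σ S : Type*} [CommRing S] {f g : MvPolynomial σ ℤ →+* S}
    (h : ∀ p, f (X p) = g (X p)) : f = g := by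
  refine RingHom.ext fun a => ?_
  rw [ringHom_eq_aeval f, ringHom_eq_aeval g, funext h]

/-- Injectivity modulo `X` suffices: an element of the kernel is divisible by `X`, the quotient is
again in the kernel, and induction kills all coefficients. -/
theorem injective_of_constantCoeff {B D : Type*} [CommRing B] [CommRing D]
    (ψ : Polynomial B →+* Polynomial D) (hX : ψ Polynomial.X = Polynomial.X)
    (h0 : ∀ m, (ψ m).coeff 0 = 0 → m.coeff 0 = 0) : Function.Injective ψ := by
  rw [injective_iff_map_eq_zero]
  have key : ∀ n : ℕ, ∀ m, ψ m = 0 → m.coeff n = 0 := by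
    intro n
    induction n with
    | zero => intro m hm; exact h0 m (by rw [hm, Polynomial.coeff_zero])
    | succ n ih =>
      intro m hm
      rw [← Polynomial.coeff_divX]
      apply ih
      have h1 := Polynomial.divX_mul_X_add m
      rw [h0 m (by rw [hm, Polynomial.coeff_zero]), map_zero, add_zero] at h1
      rw [← h1, map_mul, hX] at hm
      ext j
      have := congrArg (fun q => Polynomial.coeff q (j + 1)) hm
      simpa using this
  intro m hm
  ext n
  simpa using key n m hm

/-- Gauss's lemma: a prime element `r` of `P` has positive degree and is primitive. If it failed to
divide the primitive part of some `s ∈ P`, the two would be coprime over the fraction field, and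
clearing denominators in a Bézout relation would put a nonzero constant in `P`. -/
theorem isPrincipal_of_isPrime_of_forall_C {B : Type*} [CommRing B] [IsDomain B]
    [UniqueFactorizationMonoid B] (P : Ideal (Polynomial B)) [hP : P.IsPrime] (h0 : P ≠ ⊥)
    (hC : ∀ b, Polynomial.C b ∈ P → b = 0) : ∃ r, P = Ideal.span {r} := by
  classical
  let : NormalizedGCDMonoid B := Nonempty.some inferInstance
  obtain ⟨r, hrP, hr⟩ := Ideal.IsPrime.exists_mem_prime_of_ne_bot hP h0
  have hdeg : r.natDegree ≠ 0 := by
    intro h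
    rw [Polynomial.eq_C_of_natDegree_eq_zero h] at hrP hr
    rw [hC _ hrP, map_zero] at hr
    exact hr.ne_zero rfl
  have hprim : r.IsPrimitive := hr.irreducible.isPrimitive hdeg
  refine ⟨r, le_antisymm (fun s hs => ?_) ((Ideal.span_singleton_le_iff_mem _).2 hrP)⟩
  rw [Ideal.mem_span_singleton]
  by_cases hs0 : s = 0
  · rw [hs0]; exact dvd_zero _
  have hs1 : s.primPart ∈ P := by
    rw [s.eq_C_content_mul_primPart] at hs
    rcases hP.mem_or_mem hs with h | h
    · exact absurd (Polynomial.content_eq_zero_iff.1 (hC _ h)) hs0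
    · exact h
  rw [s.eq_C_content_mul_primPart]
  refine Dvd.dvd.mul_left ?_ _
  by_contra hdvd
  let K := FractionRing B
  have hinj : Function.Injective (algebraMap B K) := IsFractionRing.injective _ _
  have hirr : Irreducible (r.map (algebraMap B K)) :=
    (hprim.irreducible_iff_irreducible_map_fraction_map).1 hr.irreducible
  have hnd : ¬ r.map (algebraMap B K) ∣ s.primPart.map (algebraMap B K) := fun h =>
    hdvd (hprim.dvd_of_fraction_map_dvd_fraction_map (K := K) h)
  obtain ⟨u, v, huv⟩ := (hirr.coprime_iff_not_dvd).2 hnd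
  obtain ⟨b, hbM, hb⟩ := IsLocalization.integerNormalization_spec (nonZeroDivisors B) u
  obtain ⟨b', hb'M, hb'⟩ := IsLocalization.integerNormalization_spec (nonZeroDivisors B) v
  set U := IsLocalization.integerNormalization (nonZeroDivisors B) u
  set V := IsLocalization.integerNormalization (nonZeroDivisors B) v
  have key : Polynomial.C b' * U * r + Polynomial.C b * V * s.primPart =
      Polynomial.C (b * b') := by
    apply Polynomial.map_injective _ hinj
    simp only [Polynomial.map_add, Polynomial.map_mul, Polynomial.map_C, hb, hb', map_mul]
    have e1 : b • u = Polynomial.C (algebraMap B K b) * u := by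
      rw [← Polynomial.smul_eq_C_mul, algebraMap_smul]
    have e2 : b' • v = Polynomial.C (algebraMap B K b') * v := by
      rw [← Polynomial.smul_eq_C_mul, algebraMap_smul]
    rw [e1, e2]
    linear_combination (Polynomial.C (algebraMap B K b) * Polynomial.C (algebraMap B K b')) * huv
  have hmem : Polynomial.C (b * b') ∈ P := by
    rw [← key]
    exact P.add_mem (P.mul_mem_left _ hrP) (P.mul_mem_left _ hs1)
  have := hC _ hmem
  rcases mul_eq_zero.1 this with h | h
  · exact nonZeroDivisors.ne_zero hbM h
  · exact nonZeroDivisors.ne_zero hb'M h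

/-- With a coordinate equal to `1` no division is needed, so this version holds over any commutative
ring; it is applied below over a polynomial ring. -/
theorem aeval_eq_zero_of_mem_of_eq_one {N : Type*} [CommRing N] {k d : ℕ} {j : Fin (k + 1)}
    {a : CoeffRing k} (ha : a ∈ inertiaIdeal k d)
    (c : Fin (k + 1) × (Fin (k + 1) →₀ ℕ) → N) (x : Fin (k + 1) → N) (hx : x j = 1)
    (h0 : ∀ i, formValue d c x i = 0) : aeval c a = 0 := by
  obtain ⟨A, hA⟩ := exists_eq_sum_of_chartHom_eq_zero ((mem_inertiaIdeal j).1 ha)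
  have := congrArg (eval₂Hom (aeval c : CoeffRing k →ₐ[ℤ] N).toRingHom x) hA
  rw [map_sum] at this
  simp only [map_mul, eval₂Hom_chartForm c _ hx, h0, mul_zero,
    Finset.sum_const_zero] at this
  simpa using this

section Elimination

variable (k d : ℕ)

/-- The coefficients other than that of `X_0 ^ d` in the form `F_0`. -/
abbrev OtherCoeff : Type :=
  {p : Fin (k + 1) × (Fin (k + 1) →₀ ℕ) // p ≠ (0, Finsupp.single 0 d)}

/-- The coefficients of the forms `X_0 ^ (d - 1) * X_i`, `i ≠ 0`. -/
def linearCoeff (p : Fin (k + 1) × (Fin (k + 1) →₀ ℕ)) : ℤ :=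
  open scoped Classical in
  if p.1 ≠ 0 ∧ p.2 = Finsupp.single 0 (d - 1) + Finsupp.single p.1 1 then 1 else 0

variable {D : Type*} [CommRing D] (u : Fin (k + 1) × (Fin (k + 1) →₀ ℕ) → D)
  (x : Fin (k + 1) → D)

/-- The coefficients of the deformation `X_0 ^ (d - 1) * X_i + T * ∑ u_{i, α} X ^ α` of the
forms `X_0 ^ (d - 1) * X_i`, without the coefficients of `X_0 ^ d`. -/
def deformedCoeff (p : Fin (k + 1) × (Fin (k + 1) →₀ ℕ)) : Polynomial D :=
  open scoped Classical in
  if p.2 = Finsupp.single 0 d then 0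
  else (linearCoeff k d p : Polynomial D) + Polynomial.X * Polynomial.C (u p)

/-- The values of the deformed forms at `x`. -/
def deformedValue (i : Fin (k + 1)) : Polynomial D :=
  formValue d (deformedCoeff k d u) (fun l => Polynomial.C (x l)) i

/-- The coefficients of the deformed forms, adjusted to vanish at `x`. -/
def adjustedCoeff (p : Fin (k + 1) × (Fin (k + 1) →₀ ℕ)) : Polynomial D :=
  open scoped Classical in
  if p.2 = Finsupp.single 0 d then - deformedValue k d u x p.1 else deformedCoeff k d u p

variable {x}

theorem formValue_adjustedCoeff (hx : x 0 = 1) (i : Fin (k + 1)) :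
    formValue d (adjustedCoeff k d u x) (fun l => Polynomial.C (x l)) i = 0 := by
  classical
  have h1 : ∏ l, (Polynomial.C (x l)) ^ (Finsupp.single 0 d : Fin (k + 1) →₀ ℕ) l = 1 := by
    refine Finset.prod_eq_one fun l _ => ?_
    by_cases h : l = 0
    · subst h; simp [hx]
    · simp [Finsupp.single_eq_of_ne h]
  have h : ∀ α : Mon k d, adjustedCoeff k d u x (i, (α : Fin (k + 1) →₀ ℕ)) *
      ∏ l, Polynomial.C (x l) ^ (α : Fin (k + 1) →₀ ℕ) l =
      deformedCoeff k d u (i, (α : Fin (k + 1) →₀ ℕ)) *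
        ∏ l, Polynomial.C (x l) ^ (α : Fin (k + 1) →₀ ℕ) l -
      if α = ⟨Finsupp.single 0 d, single_mem_mon d 0⟩ then deformedValue k d u x i else 0 := by
    intro α
    simp only [adjustedCoeff]
    by_cases hα : (α : Fin (k + 1) →₀ ℕ) = Finsupp.single 0 d
    · rw [if_pos hα, if_pos (Subtype.ext hα), hα, deformedCoeff, if_pos rfl, h1]
      ring
    · rw [if_neg hα, if_neg (fun h => hα (congrArg Subtype.val h)), sub_zero]
  unfold formValue
  rw [Finset.sum_congr rfl fun α _ => h α, Finset.sum_sub_distrib]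
  simp [deformedValue, formValue]

/-- At `T = 0` only `X_0 ^ (d - 1) * X_i` survives, and its value is `x i` because `x 0 = 1`. -/
theorem eval_deformedValue (hd : 1 ≤ d) (hx : x 0 = 1) {i : Fin (k + 1)} (hi : i ≠ 0) :
    Polynomial.eval 0 (deformedValue k d u x i) = x i := by
  classical
  have hne : Finsupp.single 0 (d - 1) + Finsupp.single i 1 ≠
      (Finsupp.single 0 d : Fin (k + 1) →₀ ℕ) := by
    intro h
    have := DFunLike.congr_fun h i
    simp [hi.symm] at this
  change Polynomial.evalRingHom 0 (deformedValue k d u x i) = _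
  rw [deformedValue, map_formValue]
  have hmem : Finsupp.single 0 (d - 1) + Finsupp.single i 1 ∈
      Finset.finsuppAntidiag (Finset.univ : Finset (Fin (k + 1))) d := by
    rw [mem_mon]
    simp only [Finsupp.add_apply, Finset.sum_add_distrib, Finsupp.single_apply,
      Finset.sum_ite_eq, Finset.mem_univ, if_true]
    omega
  unfold formValue
  rw [Finset.sum_eq_single ⟨_, hmem⟩]
  · have h1 : linearCoeff k d (i, Finsupp.single 0 (d - 1) + Finsupp.single i 1) = 1 :=
      if_pos ⟨hi, rfl⟩
    simp only [deformedCoeff, if_neg hne, h1]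
    simp only [Finsupp.add_apply, pow_add, Finset.prod_mul_distrib]
    rw [Finset.prod_eq_single 0, Finset.prod_eq_single i]
    · simp [hx]
    · intro b _ hb
      simp [Finsupp.single_eq_of_ne hb]
    · simp
    · intro b _ hb
      simp [Finsupp.single_eq_of_ne hb]
    · simp
  · intro b _ hb
    have h1 : linearCoeff k d (i, (b : Fin (k + 1) →₀ ℕ)) = 0 :=
      if_neg fun h => hb (Subtype.ext h.2)
    simp only [deformedCoeff, h1]
    split_ifs
    · simp
    · simp
  · simp

/-- The coefficients other than that of `X_0 ^ d` in `F_0` are algebraically independent modulo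
the ideal of the resultant. -/
theorem eq_zero_of_rename_mem (hd : 1 ≤ d) (b : MvPolynomial (OtherCoeff k d) ℤ)
    (hb : rename Subtype.val b ∈ inertiaIdeal k d) : b = 0 := by
  classical
  -- Forms with the common zero `x` are built whose coefficients, other than that of `X_0 ^ d` in
  -- `F_0`, remain independent. The coordinates of `x` are chosen so that at `T = 0` the adjusted
  -- coefficient of `X_0 ^ d` in `F_i` is the variable itself for `i ≠ 0`. The remaining
  -- coefficients become variables only after multiplication by `T`, hence the deformation. The
  -- value `0` of `u` at the excluded index is immaterial, as `deformedCoeff` ignores it.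
  let u : Fin (k + 1) × (Fin (k + 1) →₀ ℕ) → MvPolynomial (OtherCoeff k d) ℤ := fun p =>
    if hp : p = (0, Finsupp.single 0 d) then 0 else X ⟨p, hp⟩
  let x : Fin (k + 1) → MvPolynomial (OtherCoeff k d) ℤ := fun i =>
    if hi : i = 0 then 1 else - X ⟨(i, Finsupp.single 0 d), fun h => hi (congrArg Prod.fst h)⟩
  have hx : x 0 = 1 := by simp [x]
  have hu : ∀ p : OtherCoeff k d, u p = X p := fun p => by simp [u, p.2]
  have h := aeval_eq_zero_of_mem_of_eq_one (j := 0) hb (adjustedCoeff k d u x)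
    (fun l => Polynomial.C (x l)) (by simp [hx]) (formValue_adjustedCoeff k d u hx)
  rw [aeval_rename] at h
  let θ : MvPolynomial (OtherCoeff k d) ℤ →+* Polynomial (MvPolynomial (OtherCoeff k d) ℤ) :=
    (aeval fun p : OtherCoeff k d =>
      if p.1.2 = Finsupp.single 0 d then Polynomial.C (X p)
      else (linearCoeff k d p.1 : Polynomial (MvPolynomial (OtherCoeff k d) ℤ)) +
        Polynomial.X * Polynomial.C (X p) : _ →ₐ[ℤ] _).toRingHom
  let ψ : Polynomial (MvPolynomial (OtherCoeff k d) ℤ) →+*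
      Polynomial (MvPolynomial (OtherCoeff k d) ℤ) := Polynomial.eval₂RingHom
    (aeval fun p : OtherCoeff k d =>
      if p.1.2 = Finsupp.single 0 d then - deformedValue k d u x p.1.1
      else Polynomial.C (X p) : _ →ₐ[ℤ] _).toRingHom Polynomial.X
  -- The specialization is factored: `θ` introduces the deformation and `ψ` substitutes the adjusted
  -- coefficients of `X_0 ^ d`. The map `ψ` is injective because it is the identity modulo `T`, and
  -- `θ` because `χ`, at `T = 1`, inverts it.
  have hcomp : ψ (θ b) = 0 := by
    rw [← h]
    refine (ringHom_eq_aeval (ψ.comp θ) b).trans ?_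
    congr 2
    ext1 p
    by_cases hp : p.1.2 = Finsupp.single 0 d
    · simp [θ, ψ, hp, adjustedCoeff]
    · simp only [RingHom.comp_apply, Function.comp_apply, adjustedCoeff, deformedCoeff, hp, if_false,
        hu]
      have h1 : θ (X p) = (linearCoeff k d p.1 : Polynomial (MvPolynomial (OtherCoeff k d) ℤ)) +
          Polynomial.X * Polynomial.C (X p) := by simp [θ, hp]
      have h2 : ψ (Polynomial.C (X p)) = Polynomial.C (X p) := by simp [ψ, hp]
      have h3 : ψ Polynomial.X = Polynomial.X := by simp [ψ]
      rw [h1, map_add, map_mul, map_intCast, h2, h3]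
  have hψ : Function.Injective ψ := by
    apply injective_of_constantCoeff
    · simp [ψ]
    · intro m hm
      have hcoeff : (Polynomial.evalRingHom 0).comp ψ =
          Polynomial.evalRingHom (0 : MvPolynomial (OtherCoeff k d) ℤ) := by
        apply Polynomial.ringHom_ext'
        · apply intHom_ext
          rintro ⟨⟨i, α⟩, hp⟩
          by_cases hα : α = Finsupp.single 0 d
          · subst hα
            have hi : i ≠ 0 := fun h => hp (by rw [h])
            simp only [ψ, RingHom.comp_apply, Polynomial.coe_eval₂RingHom, Polynomial.eval₂_C]
            simp [eval_deformedValue k d u hd hx hi]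
            simp [x, hi]
          · simp [ψ, hα]
        · simp [ψ]
      rw [Polynomial.coeff_zero_eq_eval_zero] at hm ⊢
      exact ((congrArg (fun f => f m) hcoeff).symm).trans hm
  have hθb : θ b = 0 := hψ (by rw [hcomp, map_zero])
  let χ : Polynomial (MvPolynomial (OtherCoeff k d) ℤ) →+* MvPolynomial (OtherCoeff k d) ℤ :=
    Polynomial.eval₂RingHom
      (aeval fun p : OtherCoeff k d => if p.1.2 = Finsupp.single 0 d then X p
        else X p - (linearCoeff k d p.1 : MvPolynomial (OtherCoeff k d) ℤ) :
          _ →ₐ[ℤ] _).toRingHom 1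
  have hχ : χ.comp θ = RingHom.id _ := by
    apply intHom_ext
    intro p
    by_cases hp : p.1.2 = Finsupp.single 0 d
    · simp [χ, θ, hp]
    · simp [χ, θ, hp]
  have h2 := congrArg (fun f => f b) hχ
  simp only [RingHom.comp_apply, hθb, map_zero, RingHom.id_apply] at h2
  exact h2.symm

theorem exists_inertiaIdeal_eq_span (hd : 1 ≤ d) (h0 : inertiaIdeal k d ≠ ⊥) :
    ∃ R, inertiaIdeal k d = Ideal.span {R} := by
  classical
  let p₀ : Fin (k + 1) × (Fin (k + 1) →₀ ℕ) := (0, Finsupp.single 0 d)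
  -- The coefficient of `X_0 ^ d` in `F_0` becomes the variable of a univariate polynomial ring over
  -- a factorial domain, and the contraction of the ideal to the constants is zero by
  -- `eq_zero_of_rename_mem`.
  let ε : CoeffRing k ≃ₐ[ℤ] Polynomial (MvPolynomial (OtherCoeff k d) ℤ) :=
    (renameEquiv ℤ (Equiv.optionSubtypeNe p₀).symm).trans (optionEquivLeft ℤ _)
  have hε : ∀ b, ε.symm (Polynomial.C b) = rename Subtype.val b := by
    intro b
    change ((ε.symm : _ →+* CoeffRing k).comp Polynomial.C) b =
      (rename Subtype.val : MvPolynomial (OtherCoeff k d) ℤ →ₐ[ℤ] CoeffRing k).toRingHom b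
    congr 1
    apply intHom_ext
    intro p
    simp [ε]
  let Q : Ideal (Polynomial (MvPolynomial (OtherCoeff k d) ℤ)) :=
    (inertiaIdeal k d).comap (ε.symm : _ →+* CoeffRing k)
  have hQ : ∀ a, ε a ∈ Q ↔ a ∈ inertiaIdeal k d := fun a => by simp [Q]
  have : Q.IsPrime := Ideal.IsPrime.comap _
  have hQ0 : Q ≠ ⊥ := by
    obtain ⟨a, ha, ha0⟩ := Submodule.exists_mem_ne_zero_of_ne_bot h0
    intro h
    have := (hQ a).2 ha
    rw [h, Ideal.mem_bot] at this
    exact ha0 (by simpa using this)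
  have hQC : ∀ b, Polynomial.C b ∈ Q → b = 0 := by
    intro b hb
    apply eq_zero_of_rename_mem k d hd
    rw [← hε]
    exact hb
  obtain ⟨r, hr⟩ := isPrincipal_of_isPrime_of_forall_C Q hQ0 hQC
  refine ⟨ε.symm r, ?_⟩
  ext a
  rw [← hQ, hr, Ideal.mem_span_singleton, Ideal.mem_span_singleton]
  conv_rhs => rw [← map_dvd_iff ε, AlgEquiv.apply_symm_apply]

end Elimination

/-! ### Minors of Macaulay matrices of forms without common zeros -/

/-- The Cauchy–Binet expansion before grouping terms: multilinearity in the rows. It suffices for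
showing that some minor of a left-invertible matrix is nonzero. -/
theorem det_mul_eq_sum {m p R : Type*} [CommRing R] [Fintype m] [DecidableEq m] [Fintype p]
    [DecidableEq p] (W : Matrix m p R) (M : Matrix p m R) :
    (W * M).det = ∑ e : m → p, (∏ a, W a (e a)) * (M.submatrix e id).det := by
  have h : W * M = fun a => ∑ r, W a r • M r := by
    ext a b
    simp [Matrix.mul_apply, Finset.sum_apply]
  rw [h]
  change Matrix.detRowAlternating (fun a => ∑ r, W a r • M r) = _
  rw [← AlternatingMap.coe_multilinearMap, MultilinearMap.map_sum]
  refine Finset.sum_congr rfl fun e _ => ?_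
  rw [MultilinearMap.map_smul_univ]
  rfl

theorem exists_eq_sum_of_mem_span {R : Type*} [CommRing R] {k d n : ℕ}
    {F : Fin (k + 1) → MvPolynomial (Fin (k + 1)) R} (hF : ∀ i, (F i).IsHomogeneous d)
    {P : MvPolynomial (Fin (k + 1)) R} (hP : P.IsHomogeneous (n + d))
    (hmem : P ∈ Ideal.span (Set.range F)) :
    ∃ A : Fin (k + 1) → MvPolynomial (Fin (k + 1)) R,
      (∀ i, (A i).IsHomogeneous n) ∧ P = ∑ i, A i * F i := by
  classical
  obtain ⟨A, hA⟩ := (Ideal.mem_span_range_iff_exists_fun).1 hmem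
  refine ⟨fun i => homogeneousComponent n (A i),
    fun i => homogeneousComponent_isHomogeneous n (A i), ?_⟩
  have h1 : homogeneousComponent (n + d) P = P := by
    rw [homogeneousComponent_of_mem hP, if_pos rfl]
  have h2 : ∀ i, homogeneousComponent (n + d) (A i * F i) =
      homogeneousComponent n (A i) * F i := by
    intro i
    let : GradedAlgebra (homogeneousSubmodule (Fin (k + 1)) R) := gradedAlgebra
    have hc : ∀ (q : MvPolynomial (Fin (k + 1)) R) (m : ℕ),
        (DirectSum.decompose (homogeneousSubmodule (Fin (k + 1)) R) q m : MvPolynomial _ R) =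
          homogeneousComponent m q := fun q m => decomposition.decompose'_apply q m
    have := DirectSum.coe_decompose_mul_add_of_right_mem (homogeneousSubmodule (Fin (k + 1)) R)
      (a := A i) (i := n) (hF i)
    rw [hc, hc] at this
    exact this
  rw [← h1, ← hA, map_sum]
  exact Finset.sum_congr rfl fun i _ => h2 i

/-- By the Nullstellensatz a power `X_j ^ M` of each variable lies in the ideal of the forms, so
every monomial of large degree does. Writing monomials in terms of the forms gives a left inverse of
the Macaulay matrix, whose maximal minors therefore cannot all vanish. -/
theorem exists_det_macaulay_ne_zero {K : Type*} [Field K] [IsAlgClosed K] {k d : ℕ}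
    {F : Fin (k + 1) → MvPolynomial (Fin (k + 1)) K} (hF : ∀ i, (F i).IsHomogeneous d)
    (h0 : ∀ x, (∀ i, eval x (F i) = 0) → x = 0) :
    ∃ (n : ℕ) (e : Mon k (n + d) → Fin (k + 1) × Mon k n),
      ((genMacaulay k d n F).submatrix e id).det ≠ 0 := by
  classical
  have hrad : ∀ j, (X j : MvPolynomial (Fin (k + 1)) K) ∈
      (Ideal.span (Set.range F)).radical := by
    intro j
    rw [← vanishingIdeal_zeroLocus_eq_radical (K := K)]
    rw [mem_vanishingIdeal_iff]
    intro x hx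
    have : x = 0 := by
      apply h0
      intro i
      have := (mem_zeroLocus_iff.1 hx) (F i) (Ideal.subset_span ⟨i, rfl⟩)
      simpa [aeval_eq_eval] using this
    simp [this]
  choose m hm using hrad
  set M := ∑ j, m j with hM
  have hX : ∀ j, (X j : MvPolynomial (Fin (k + 1)) K) ^ M ∈ Ideal.span (Set.range F) := fun j =>
    Ideal.pow_mem_of_pow_mem _ (hm j) (Finset.single_le_sum (f := m) (fun _ _ => Nat.zero_le _)
      (Finset.mem_univ j))
  refine ⟨(k + 1) * M, ?_⟩
  set n := (k + 1) * M
  have hmon : ∀ α : Mon k (n + d), (monomial (α : Fin (k + 1) →₀ ℕ) (1 : K)) ∈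
      Ideal.span (Set.range F) := by
    intro α
    obtain ⟨j, hj⟩ : ∃ j, M ≤ (α : Fin (k + 1) →₀ ℕ) j := by
      by_contra! h
      have h1 : ∑ j, (α : Fin (k + 1) →₀ ℕ) j < ∑ _j : Fin (k + 1), M :=
        Finset.sum_lt_sum_of_nonempty Finset.univ_nonempty fun j _ => h j
      rw [α.sum_eq] at h1
      simp only [Finset.sum_const, Finset.card_univ, Fintype.card_fin, smul_eq_mul] at h1
      omega
    have : monomial (α : Fin (k + 1) →₀ ℕ) (1 : K) =
        monomial ((α : Fin (k + 1) →₀ ℕ) - Finsupp.single j M) 1 * X j ^ M := by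
      rw [X_pow_eq_monomial, monomial_mul, one_mul, tsub_add_cancel_of_le]
      exact Finsupp.single_le_iff.2 hj
    rw [this]
    exact Ideal.mul_mem_left _ _ (hX j)
  have hmon' := fun α : Mon k (n + d) => exists_eq_sum_of_mem_span hF
    (isHomogeneous_monomial (1 : K) (by rw [Finsupp.degree_eq_sum, α.sum_eq])) (hmon α)
  choose A hA hAF using hmon'
  let W : Matrix (Mon k (n + d)) (Fin (k + 1) × Mon k n) K := fun α p => (A α p.1).coeff p.2
  have hW : W * genMacaulay k d n F = 1 := by
    ext α γ
    have h1 : monomial (α : Fin (k + 1) →₀ ℕ) (1 : K) = ∑ i, ∑ β : Mon k n,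
        C ((A α i).coeff β) * (monomial (β : Fin (k + 1) →₀ ℕ) 1 * F i) := by
      rw [hAF α]
      refine Finset.sum_congr rfl fun i _ => ?_
      conv_lhs => rw [isHomogeneous_eq_sum (hA α i), Finset.sum_mul]
      refine Finset.sum_congr rfl fun β _ => ?_
      rw [← mul_assoc, C_mul_monomial, mul_one]
    have h2 := congrArg (coeff (γ : Fin (k + 1) →₀ ℕ)) h1
    simp only [coeff_sum, coeff_C_mul, coeff_monomial] at h2
    rw [Matrix.mul_apply, Fintype.sum_prod_type, Matrix.one_apply]
    refine h2.symm.trans ?_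
    by_cases h : α = γ
    · rw [if_pos h, if_pos (congrArg Subtype.val h)]
    · rw [if_neg h, if_neg fun h' => h (Subtype.ext h')]
  by_contra! hdet
  have := det_mul_eq_sum W (genMacaulay k d n F)
  rw [hW, Matrix.det_one, Finset.sum_eq_zero] at this
  · exact one_ne_zero this
  · intro e _
    rw [hdet e, mul_zero]

theorem evalCoeffs_det_macaulay {R : Type*} [CommRing R] {k d n : ℕ}
    {F : Fin (k + 1) → MvPolynomial (Fin (k + 1)) R} (hF : ∀ i, (F i).IsHomogeneous d)
    (e : Mon k (n + d) → Fin (k + 1) × Mon k n) :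
    evalCoeffs F ((genMacaulay k d n (genericForm k d)).submatrix e id).det =
      ((genMacaulay k d n F).submatrix e id).det := by
  change (aeval (fun p : Fin (k + 1) × (Fin (k + 1) →₀ ℕ) => (F p.1).coeff p.2) :
      CoeffRing k →ₐ[ℤ] R).toRingHom _ = _
  rw [RingHom.map_det, RingHom.mapMatrix_apply, ← Matrix.submatrix_map, map_macaulay]
  simp only [map_genericForm hF]

/-- A generator of the ideal of the resultant does not vanish on forms without common zeros. -/
theorem evalCoeffs_ne_zero_of_le_span {K : Type*} [Field K] [IsAlgClosed K] {k d : ℕ}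
    {F : Fin (k + 1) → MvPolynomial (Fin (k + 1)) K} (hF : ∀ i, (F i).IsHomogeneous d)
    (h0 : ∀ x, (∀ i, eval x (F i) = 0) → x = 0) {P : CoeffRing k}
    (hP : inertiaIdeal k d ≤ Ideal.span {P}) : evalCoeffs F P ≠ 0 := by
  obtain ⟨n, e, he⟩ := exists_det_macaulay_ne_zero hF h0
  -- The degree `n` may be far from the critical one. This does no harm, because minors of every
  -- degree lie in the inertia ideal and so are multiples of `P`.
  obtain ⟨Q, hQ⟩ := Ideal.mem_span_singleton.1 (hP (det_macaulay_mem (d := d) e))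
  intro h
  apply he
  rw [← evalCoeffs_det_macaulay hF, hQ]
  simp only [evalCoeffs, map_mul] at h ⊢
  rw [h, zero_mul]

/-! ### Degrees in the coefficients of one of the forms -/

/-- The scaling of the coefficients of the `i`-th form by an indeterminate. -/
def blockScale (k : ℕ) (i : Fin (k + 1)) : CoeffRing k →ₐ[ℤ] Polynomial (CoeffRing k) :=
  aeval fun p => Polynomial.C (X p) * Polynomial.X ^ (if p.1 = i then 1 else 0)

/-- The degree of a monomial in the coefficients of the `i`-th form. -/
def blockWeight {k : ℕ} (i : Fin (k + 1))
    (e : Fin (k + 1) × (Fin (k + 1) →₀ ℕ) →₀ ℕ) : ℕ :=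
  ∑ p ∈ e.support, (if p.1 = i then 1 else 0) * e p

theorem blockScale_monomial {k : ℕ} (i : Fin (k + 1))
    (e : Fin (k + 1) × (Fin (k + 1) →₀ ℕ) →₀ ℕ) (r : ℤ) :
    blockScale k i (monomial e r) =
      Polynomial.C (monomial e r) * Polynomial.X ^ blockWeight i e := by
  rw [blockScale, aeval_monomial, Finsupp.prod]
  simp only [mul_pow, Finset.prod_mul_distrib, ← pow_mul, Finset.prod_pow_eq_pow_sum]
  rw [monomial_eq, Finsupp.prod, map_mul, map_prod, ← mul_assoc]
  simp [blockWeight]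

theorem coeff_coeff_blockScale {k : ℕ} (i : Fin (k + 1)) (a : CoeffRing k) (n : ℕ)
    (e : Fin (k + 1) × (Fin (k + 1) →₀ ℕ) →₀ ℕ) :
    ((blockScale k i a).coeff n).coeff e = if n = blockWeight i e then a.coeff e else 0 := by
  classical
  induction a using MvPolynomial.induction_on' with
  | monomial u r =>
    rw [blockScale_monomial, Polynomial.coeff_C_mul_X_pow]
    by_cases hu : u = e
    · subst hu
      split_ifs <;> simp
    · split_ifs <;> simp [coeff_monomial, hu]
  | add p q hp hq =>
    rw [map_add, Polynomial.coeff_add, coeff_add, hp, hq, coeff_add]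
    split_ifs <;> simp

theorem blockWeight_eq {k : ℕ} {i : Fin (k + 1)} {a : CoeffRing k} {n : ℕ}
    (ha : blockScale k i a = Polynomial.C a * Polynomial.X ^ n)
    {e : Fin (k + 1) × (Fin (k + 1) →₀ ℕ) →₀ ℕ} (he : e ∈ a.support) : blockWeight i e = n := by
  have h := coeff_coeff_blockScale i a n e
  rw [ha, Polynomial.coeff_C_mul_X_pow, if_pos rfl] at h
  by_contra hne
  rw [if_neg (Ne.symm hne)] at h
  exact mem_support_iff.1 he h

theorem natDegree_aeval_le {L : Type*} [CommRing L] {k : ℕ} {i : Fin (k + 1)}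
    {a : CoeffRing k} {n : ℕ} (ha : blockScale k i a = Polynomial.C a * Polynomial.X ^ n)
    (c : Fin (k + 1) × (Fin (k + 1) →₀ ℕ) → Polynomial L)
    (hc : ∀ p, (c p).natDegree ≤ if p.1 = i then 1 else 0) :
    (aeval c a).natDegree ≤ n := by
  rw [aeval_def, eval₂_eq]
  refine Polynomial.natDegree_sum_le_of_forall_le _ _ fun e he => ?_
  rw [← blockWeight_eq ha he]
  refine Polynomial.natDegree_mul_le.trans ?_
  have h1 : (algebraMap ℤ (Polynomial L) (a.coeff e)).natDegree = 0 := by simp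
  rw [h1, zero_add]
  refine (Polynomial.natDegree_prod_le _ _).trans (Finset.sum_le_sum fun p _ => ?_)
  refine Polynomial.natDegree_pow_le.trans ?_
  rw [mul_comm]
  exact Nat.mul_le_mul_right _ (hc p)

theorem eval_one_blockScale {k : ℕ} (i : Fin (k + 1)) (a : CoeffRing k) :
    (blockScale k i a).eval 1 = a := by
  have : (Polynomial.evalRingHom 1).comp (blockScale k i : CoeffRing k →+* _) =
      RingHom.id (CoeffRing k) := by
    apply intHom_ext
    intro p
    simp only [blockScale, RingHom.comp_apply, RingHom.coe_coe, aeval_X, RingHom.id_apply]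
    split_ifs <;> simp
  exact congrArg (fun f => f a) this

theorem blockScale_ne_zero {k : ℕ} (i : Fin (k + 1)) {a : CoeffRing k} (ha : a ≠ 0) :
    blockScale k i a ≠ 0 := by
  intro h
  apply ha
  rw [← eval_one_blockScale i a, h, Polynomial.eval_zero]

/-- Over a domain both degree and trailing degree are additive. They agree for the product, so they
agree for each factor. -/
theorem eq_C_mul_X_pow_of_mul_eq {A : Type*} [CommRing A] [IsDomain A] {p q : Polynomial A} {a : A}
    {n : ℕ} (ha : a ≠ 0) (h : p * q = Polynomial.C a * Polynomial.X ^ n) :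
    p = Polynomial.C p.leadingCoeff * Polynomial.X ^ p.natDegree := by
  have hpq : p * q ≠ 0 := by
    rw [h]
    exact mul_ne_zero (Polynomial.C_ne_zero.2 ha) (pow_ne_zero _ Polynomial.X_ne_zero)
  have hp := left_ne_zero_of_mul hpq
  have hq := right_ne_zero_of_mul hpq
  have h1 : p.natDegree + q.natDegree = n := by
    rw [← Polynomial.natDegree_mul hp hq, h, Polynomial.natDegree_C_mul_X_pow _ _ ha]
  have h2 : p.natTrailingDegree + q.natTrailingDegree = n := by
    rw [← Polynomial.natTrailingDegree_mul hp hq, h, Polynomial.C_mul_X_pow_eq_monomial,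
      Polynomial.natTrailingDegree_monomial ha]
  have h3 := p.natTrailingDegree_le_natDegree
  have h4 := q.natTrailingDegree_le_natDegree
  ext m
  rw [Polynomial.coeff_C_mul_X_pow]
  split_ifs with hm
  · rw [hm]; rfl
  · rcases lt_or_gt_of_ne hm with hm | hm
    · exact Polynomial.coeff_eq_zero_of_lt_natTrailingDegree (by omega)
    · exact Polynomial.coeff_eq_zero_of_natDegree_lt hm

/-- Homogeneity in one block of coefficients passes to divisors; evaluating the scaling parameter at
`1` identifies the leading coefficient with `a`. -/
theorem blockScale_of_dvd {k : ℕ} {i : Fin (k + 1)} {a b : CoeffRing k} {n : ℕ} (hb : b ≠ 0)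
    (hb' : blockScale k i b = Polynomial.C b * Polynomial.X ^ n) (hab : a ∣ b) :
    blockScale k i a = Polynomial.C a * Polynomial.X ^ (blockScale k i a).natDegree := by
  obtain ⟨q, rfl⟩ := hab
  have h := eq_C_mul_X_pow_of_mul_eq hb ((map_mul (blockScale k i) a q).symm.trans hb')
  have h1 := congrArg (Polynomial.eval 1) h
  rw [eval_one_blockScale] at h1
  simp only [Polynomial.eval_mul, Polynomial.eval_C, Polynomial.eval_pow, Polynomial.eval_X,
    one_pow, mul_one] at h1
  rw [← h1] at h
  exact h

theorem natDegree_blockScale_le_of_dvd {k : ℕ} {i : Fin (k + 1)} {a b : CoeffRing k} {n : ℕ}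
    (hb : b ≠ 0) (hb' : blockScale k i b = Polynomial.C b * Polynomial.X ^ n) (hab : a ∣ b) :
    (blockScale k i a).natDegree ≤ n := by
  have h := Polynomial.natDegree_le_of_dvd (map_dvd (blockScale k i) hab) (blockScale_ne_zero i hb)
  rwa [hb', Polynomial.natDegree_C_mul_X_pow _ _ hb] at h

theorem eq_C_of_blockScale {k : ℕ} {a : CoeffRing k}
    (ha : ∀ i, blockScale k i a = Polynomial.C a) : a = C (a.coeff 0) := by
  classical
  ext e
  rw [coeff_C]
  split_ifs with he
  · rw [he]
  · by_contra hne
    apply he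
    symm
    ext p
    have h := blockWeight_eq (n := 0) (by rw [ha p.1, pow_zero, mul_one]) (mem_support_iff.2 hne)
    by_contra hp
    rw [blockWeight, Finset.sum_eq_zero_iff] at h
    have := h p (Finsupp.mem_support_iff.2 hp)
    rw [if_pos rfl, one_mul] at this
    exact hp this

/-! ### Macaulay's minors -/

theorem genMacaulay_apply {R : Type*} [CommRing R] {k d n : ℕ}
    (F : Fin (k + 1) → MvPolynomial (Fin (k + 1)) R) (p : Fin (k + 1) × Mon k n)
    (α : Mon k (n + d)) :
    genMacaulay k d n F p α = if (p.2 : Fin (k + 1) →₀ ℕ) ≤ α then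
      (F p.1).coeff ((α : Fin (k + 1) →₀ ℕ) - (p.2 : Fin (k + 1) →₀ ℕ)) else 0 := by
  classical
  rw [genMacaulay, coeff_monomial_mul', one_mul]

theorem blockScale_genMacaulay {k d n : ℕ} (i : Fin (k + 1)) (p : Fin (k + 1) × Mon k n)
    (α : Mon k (n + d)) :
    blockScale k i (genMacaulay k d n (genericForm k d) p α) =
      Polynomial.X ^ (if p.1 = i then 1 else 0) *
        Polynomial.C (genMacaulay k d n (genericForm k d) p α) := by
  classical
  rw [genMacaulay_apply]
  split_ifs with h1 h2
  · rw [coeff_genericForm]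
    · rw [blockScale, aeval_X, if_pos h2, mul_comm]
    · have h3 : ∑ j, ((α : Fin (k + 1) →₀ ℕ) - (p.2 : Fin (k + 1) →₀ ℕ)) j +
          ∑ j, (p.2 : Fin (k + 1) →₀ ℕ) j = ∑ j, (α : Fin (k + 1) →₀ ℕ) j := by
        rw [← Finset.sum_add_distrib]
        exact Finset.sum_congr rfl fun j _ => tsub_add_cancel_of_le (h1 j)
      rw [p.2.sum_eq, α.sum_eq] at h3
      omega
  · rw [coeff_genericForm]
    · rw [blockScale, aeval_X, if_neg h2, mul_comm]
    · have h3 : ∑ j, ((α : Fin (k + 1) →₀ ℕ) - (p.2 : Fin (k + 1) →₀ ℕ)) j +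
          ∑ j, (p.2 : Fin (k + 1) →₀ ℕ) j = ∑ j, (α : Fin (k + 1) →₀ ℕ) j := by
        rw [← Finset.sum_add_distrib]
        exact Finset.sum_congr rfl fun j _ => tsub_add_cancel_of_le (h1 j)
      rw [p.2.sum_eq, α.sum_eq] at h3
      omega
  · simp
  · simp

/-- Scaling `F_i` multiplies exactly the rows of the matrix that come from `F_i`, so the degree of
the minor in that block is the number of those rows. -/
theorem blockScale_det_macaulay {k d n : ℕ} (i : Fin (k + 1))
    (e : Mon k (n + d) → Fin (k + 1) × Mon k n) :
    blockScale k i ((genMacaulay k d n (genericForm k d)).submatrix e id).det =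
      Polynomial.C ((genMacaulay k d n (genericForm k d)).submatrix e id).det *
        Polynomial.X ^ (∑ α, if (e α).1 = i then 1 else 0) := by
  have h := Matrix.det_mul_column
    (fun α => (Polynomial.X : Polynomial (CoeffRing k)) ^ (if (e α).1 = i then 1 else 0))
    ((Polynomial.C : CoeffRing k →+* Polynomial (CoeffRing k)).mapMatrix
      ((genMacaulay k d n (genericForm k d)).submatrix e id))
  rw [← RingHom.map_det, Finset.prod_pow_eq_pow_sum, mul_comm] at h
  rw [← h]
  change (blockScale k i : CoeffRing k →+* Polynomial (CoeffRing k)) _ = _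
  rw [RingHom.map_det]
  congr 1
  ext α γ : 1
  simp only [RingHom.mapMatrix_apply, Matrix.map_apply, Matrix.submatrix_apply, id_eq,
    Matrix.of_apply]
  exact blockScale_genMacaulay i (e α) γ

/-- Pigeonhole in the critical degree. The index `i` is used only as a last resort, which keeps the
number of rows from `F_i` small. -/
theorem exists_le_of_mon {k d : ℕ} (i : Fin (k + 1)) (α : Mon k (k * (d - 1) + d)) :
    ∃ l, d ≤ (α : Fin (k + 1) →₀ ℕ) l ∧ (l = i → ∀ j ≠ i, (α : Fin (k + 1) →₀ ℕ) j < d) := by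
  by_cases h : ∃ j ≠ i, d ≤ (α : Fin (k + 1) →₀ ℕ) j
  · obtain ⟨j, hj, hjd⟩ := h
    exact ⟨j, hjd, fun h => absurd h hj⟩
  · push Not at h
    refine ⟨i, ?_, fun _ => h⟩
    have h1 := α.sum_eq
    rw [← Finset.add_sum_erase _ _ (Finset.mem_univ i)] at h1
    have h2 : ∑ j ∈ Finset.univ.erase i, (α : Fin (k + 1) →₀ ℕ) j ≤
        ∑ _j ∈ Finset.univ.erase i, (d - 1) :=
      Finset.sum_le_sum fun j hj => Nat.le_sub_one_of_lt (h j (Finset.ne_of_mem_erase hj))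
    simp only [Finset.sum_const, Finset.card_erase_of_mem (Finset.mem_univ i), Finset.card_univ,
      Fintype.card_fin, smul_eq_mul, Nat.add_sub_cancel] at h2
    omega

/-- As the total degree is fixed, the `k` exponents other than the `i`-th determine the monomial,
and each takes at most `d` values. -/
theorem card_reduced_le {k d n : ℕ} (i : Fin (k + 1)) (s : Finset (Mon k n))
    (hs : ∀ α ∈ s, ∀ j ≠ i, (α : Fin (k + 1) →₀ ℕ) j < d) : s.card ≤ d ^ k := by
  classical
  have h := Finset.card_le_card_of_injOn (s := s)
    (t := Fintype.piFinset fun _ : {j // j ≠ i} => Finset.range d)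
    (fun α j => (α : Fin (k + 1) →₀ ℕ) j.1) ?_ ?_
  · simpa using h
  · intro α hα
    simp only [Finset.mem_coe, Fintype.mem_piFinset, Finset.mem_range]
    exact fun j => hs α hα j.1 j.2
  · intro α _ γ _ h
    have h1 : ∀ j ≠ i, (α : Fin (k + 1) →₀ ℕ) j = (γ : Fin (k + 1) →₀ ℕ) j := fun j hj =>
      congrFun h ⟨j, hj⟩
    apply Subtype.ext
    ext j
    by_cases hj : j = i
    · have h2 := α.sum_eq.trans γ.sum_eq.symm
      have h3 : ∑ j ∈ Finset.univ.erase i, (α : Fin (k + 1) →₀ ℕ) j =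
          ∑ j ∈ Finset.univ.erase i, (γ : Fin (k + 1) →₀ ℕ) j :=
        Finset.sum_congr rfl fun j hj => h1 j (Finset.ne_of_mem_erase hj)
      rw [← Finset.add_sum_erase _ _ (Finset.mem_univ i),
        ← Finset.add_sum_erase _ _ (Finset.mem_univ i), h3] at h2
      rw [hj]
      exact Nat.add_right_cancel h2
    · exact h1 j hj

/-- There is a maximal minor of the Macaulay matrix of the critical degree that takes the value `1`
at `X_0 ^ d, …, X_k ^ d` and is homogeneous of degree at most `d ^ k` in the coefficients of the
`i`-th form. -/
theorem exists_macaulay_minor {k d : ℕ} (i : Fin (k + 1)) :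
    ∃ e : Mon k (k * (d - 1) + d) → Fin (k + 1) × Mon k (k * (d - 1)),
      evalCoeffs (fun i => (X i : MvPolynomial (Fin (k + 1)) ℤ) ^ d)
        ((genMacaulay k d (k * (d - 1)) (genericForm k d)).submatrix e id).det = 1 ∧
      ∃ n ≤ d ^ k, blockScale k i
          ((genMacaulay k d (k * (d - 1)) (genericForm k d)).submatrix e id).det =
        Polynomial.C ((genMacaulay k d (k * (d - 1)) (genericForm k d)).submatrix e id).det *
          Polynomial.X ^ n := by
  classical
  choose l hl hl' using exists_le_of_mon (k := k) (d := d) i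
  have hle : ∀ α : Mon k (k * (d - 1) + d),
      Finsupp.single (l α) d ≤ (α : Fin (k + 1) →₀ ℕ) := fun α => Finsupp.single_le_iff.2 (hl α)
  have hsum : ∀ α : Mon k (k * (d - 1) + d), (α : Fin (k + 1) →₀ ℕ) - Finsupp.single (l α) d ∈
      Finset.finsuppAntidiag (Finset.univ : Finset (Fin (k + 1))) (k * (d - 1)) := by
    intro α
    have h1 : ∑ j, ((α : Fin (k + 1) →₀ ℕ) - Finsupp.single (l α) d) j +
        ∑ j, (Finsupp.single (l α) d : Fin (k + 1) →₀ ℕ) j = ∑ j, (α : Fin (k + 1) →₀ ℕ) j := by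
      rw [← Finset.sum_add_distrib]
      exact Finset.sum_congr rfl fun j _ => tsub_add_cancel_of_le (hle α j)
    rw [α.sum_eq, mem_mon.1 (single_mem_mon d (l α))] at h1
    rw [mem_mon]
    omega
  -- Row `α` is the multiple of `F_l` by `X ^ α / X_l ^ d`. For the power forms this multiple is `X
  -- ^ α` itself, so the matrix is the identity.
  refine ⟨fun α => (l α, ⟨_, hsum α⟩), ?_, _, ?_, blockScale_det_macaulay i _⟩
  · rw [evalCoeffs_det_macaulay fun j => by simpa using (isHomogeneous_X ℤ j).pow d]
    have : ((genMacaulay k d (k * (d - 1)) fun i => (X i : MvPolynomial (Fin (k + 1)) ℤ) ^ d).submatrix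
        (fun α => (l α, ⟨(α : Fin (k + 1) →₀ ℕ) - Finsupp.single (l α) d, hsum α⟩)) id) = 1 := by
      ext α γ
      simp only [genMacaulay, Matrix.submatrix_apply, id_eq]
      rw [X_pow_eq_monomial, monomial_mul, one_mul, coeff_monomial, tsub_add_cancel_of_le (hle α),
        Matrix.one_apply]
      by_cases h : α = γ
      · rw [if_pos h, if_pos (congrArg Subtype.val h)]
      · rw [if_neg h, if_neg fun h' => h (Subtype.ext h')]
    rw [this, Matrix.det_one]
  · rw [Finset.sum_boole]
    apply card_reduced_le i
    intro α hα
    exact hl' α (Finset.mem_filter.1 hα).2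

/-! ### Forms that split into linear factors -/

section SplitForms

variable (k d : ℕ) (i : Fin (k + 1))

/-- The product `∏_{m < d} (X_l - m X_i)`. -/
def splitForm (l : Fin (k + 1)) : MvPolynomial (Fin (k + 1)) ℂ :=
  ∏ m ∈ Finset.range d, (X l - C (m : ℂ) * X i)

/-- The form `X_i ^ (d - 1) ∑_{l ≠ i} d ^ l X_l`. -/
def digitForm : MvPolynomial (Fin (k + 1)) ℂ :=
  X i ^ (d - 1) * ∑ l ∈ Finset.univ.erase i, C ((d : ℂ) ^ (l : ℕ)) * X l

/-- The system of the forms `splitForm` and `digitForm - b X_i ^ d`. -/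
def splitSystem (b : ℂ) (l : Fin (k + 1)) : MvPolynomial (Fin (k + 1)) ℂ :=
  if l = i then digitForm k d i - C b * X i ^ d else splitForm k d i l

/-- The coefficients of `splitSystem` as polynomials in `b`. -/
def splitCoeff (p : Fin (k + 1) × (Fin (k + 1) →₀ ℕ)) : Polynomial ℂ :=
  if p.1 = i then Polynomial.C ((digitForm k d i).coeff p.2) -
      Polynomial.X * Polynomial.C ((X i ^ d : MvPolynomial (Fin (k + 1)) ℂ).coeff p.2)
    else Polynomial.C ((splitForm k d i p.1).coeff p.2)

theorem splitSystem_isHomogeneous (hd : 1 ≤ d) (b : ℂ) (l : Fin (k + 1)) :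
    (splitSystem k d i b l).IsHomogeneous d := by
  unfold splitSystem
  split_ifs
  · refine IsHomogeneous.sub ?_ ?_
    · have h1 : (∑ l ∈ Finset.univ.erase i, C ((d : ℂ) ^ (l : ℕ)) * X l :
          MvPolynomial (Fin (k + 1)) ℂ).IsHomogeneous 1 :=
        IsHomogeneous.sum _ _ _ fun l _ => (isHomogeneous_X ℂ l).C_mul _
      have := ((isHomogeneous_X ℂ i).pow (d - 1)).mul h1
      rw [one_mul, Nat.sub_add_cancel hd] at this
      exact this
    · have := ((isHomogeneous_X ℂ i).pow d).C_mul b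
      rwa [one_mul] at this
  · have := IsHomogeneous.prod (Finset.range d)
      (fun m : ℕ => (X l - C (m : ℂ) * X i : MvPolynomial (Fin (k + 1)) ℂ)) (fun _ => 1)
      fun m _ => (isHomogeneous_X ℂ l).sub ((isHomogeneous_X ℂ i).C_mul _)
    simpa [splitForm] using this

theorem natDegree_splitCoeff_le (p : Fin (k + 1) × (Fin (k + 1) →₀ ℕ)) :
    (splitCoeff k d i p).natDegree ≤ if p.1 = i then 1 else 0 := by
  unfold splitCoeff
  split_ifs
  · refine (Polynomial.natDegree_sub_le _ _).trans (max_le (by simp) ?_)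
    refine Polynomial.natDegree_mul_le.trans ?_
    simp
  · simp

theorem eval_aeval_splitCoeff (a : CoeffRing k) (b : ℂ) :
    (aeval (splitCoeff k d i) a).eval b = evalCoeffs (splitSystem k d i b) a := by
  refine (ringHom_eq_aeval ((Polynomial.evalRingHom b).comp
    (aeval (splitCoeff k d i) : CoeffRing k →ₐ[ℤ] Polynomial ℂ).toRingHom) a).trans ?_
  unfold evalCoeffs
  congr 2
  ext1 p
  simp only [RingHom.comp_apply, AlgHom.toRingHom_eq_coe, RingHom.coe_coe, aeval_X, splitCoeff,
    splitSystem]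
  split_ifs
  · simp only [Polynomial.coe_evalRingHom, Polynomial.eval_sub, Polynomial.eval_C,
      Polynomial.eval_mul, Polynomial.eval_X, coeff_sub, coeff_C_mul]
  · simp

theorem eval_splitForm (x : Fin (k + 1) → ℂ) (l : Fin (k + 1)) :
    eval x (splitForm k d i l) = ∏ m ∈ Finset.range d, (x l - m * x i) := by
  simp [splitForm, map_prod]

theorem eval_splitSystem_self (b : ℂ) (x : Fin (k + 1) → ℂ) :
    eval x (splitSystem k d i b i) =
      x i ^ (d - 1) * ∑ l ∈ Finset.univ.erase i, (d : ℂ) ^ (l : ℕ) * x l - b * x i ^ d := by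
  simp [splitSystem, digitForm, map_sum]

theorem eq_zero_of_eval_splitSystem (hd : 1 ≤ d) (x : Fin (k + 1) → ℂ)
    (hx : ∀ l, eval x (splitSystem k d i (-1) l) = 0) : x = 0 := by
  have h1 : ∀ l, l ≠ i → ∃ m : ℕ, x l = m * x i := by
    intro l hl
    have := hx l
    rw [splitSystem, if_neg hl, eval_splitForm, Finset.prod_eq_zero_iff] at this
    obtain ⟨m, _, hm⟩ := this
    exact ⟨m, sub_eq_zero.1 hm⟩
  have hi : x i = 0 := by
    by_contra h0
    choose! m hm using h1
    have h2 := hx i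
    rw [eval_splitSystem_self, Finset.sum_congr rfl fun l hl => by
      rw [hm l (Finset.ne_of_mem_erase hl), ← mul_assoc], ← Finset.sum_mul] at h2
    have h3 : x i ^ d = x i ^ (d - 1) * x i := by
      rw [← pow_succ, Nat.sub_add_cancel hd]
    rw [h3] at h2
    have h4 : (x i ^ (d - 1) * x i) *
        (∑ l ∈ Finset.univ.erase i, (d : ℂ) ^ (l : ℕ) * (m l : ℂ) + 1) = 0 := by
      linear_combination h2
    rcases mul_eq_zero.1 h4 with h | h
    · exact mul_ne_zero (pow_ne_zero _ h0) h0 h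
    · have h5 : ((∑ l ∈ Finset.univ.erase i, d ^ (l : ℕ) * m l + 1 : ℕ) : ℂ) = 0 := by
        push_cast
        exact h
      exact Nat.succ_ne_zero _ (Nat.cast_eq_zero.1 h5)
  funext l
  by_cases hl : l = i
  · rw [hl, hi]; rfl
  · obtain ⟨m, hm⟩ := h1 l hl
    rw [hm, hi, mul_zero]; rfl

/-- The values of the sums of digits `∑_{l ≠ i} m_l d ^ l`. -/
theorem exists_digit_values (hd : 1 ≤ d) : ∃ s : Finset ℕ, d ^ k ≤ s.card ∧ ∀ b ∈ s,
    ∃ m : Fin (k + 1) → ℕ, (∀ l, m l < d) ∧ b = ∑ l ∈ Finset.univ.erase i, d ^ (l : ℕ) * m l := by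
  classical
  -- The digits at the `k` positions `l ≠ i` are free and the digit at `i` is `0`; uniqueness of
  -- base `d` expansions gives `d ^ k` distinct sums.
  let v : ({l // l ≠ i} → Fin d) → ℕ := fun m => (finFunctionFinEquiv (fun l : Fin (k + 1) =>
    if h : l ≠ i then m ⟨l, h⟩ else (⟨0, hd⟩ : Fin d)) : ℕ)
  have hv : Function.Injective v := by
    intro m m' h
    have := finFunctionFinEquiv.injective (Fin.ext h)
    funext l
    have h1 := congrFun this l.1
    simpa [l.2] using h1
  refine ⟨Finset.univ.map ⟨v, hv⟩, ?_, ?_⟩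
  · simp
  · intro b hb
    obtain ⟨m, -, rfl⟩ := Finset.mem_map.1 hb
    refine ⟨fun l => if h : l ≠ i then m ⟨l, h⟩ else (⟨0, hd⟩ : Fin d), fun l => ?_, ?_⟩
    · dsimp only
      split_ifs
      · exact Fin.is_lt _
      · exact hd
    simp only [v, Function.Embedding.coeFn_mk, finFunctionFinEquiv_apply]
    rw [← Finset.add_sum_erase _ _ (Finset.mem_univ i)]
    simp only [ne_eq, not_true_eq_false, dite_false, zero_mul, zero_add]
    refine Finset.sum_congr rfl fun l _ => ?_
    rw [mul_comm]
    split_ifs <;> rfl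

/-- A generator of the ideal of the resultant has degree at least `d ^ k` in the coefficients of the
`i`-th form. -/
theorem pow_le_of_span (hd : 1 ≤ d) {P : CoeffRing k} (hP : inertiaIdeal k d = Ideal.span {P})
    {n : ℕ} (hn : blockScale k i P = Polynomial.C P * Polynomial.X ^ n) : d ^ k ≤ n := by
  classical
  have hmem : P ∈ inertiaIdeal k d := hP ▸ Ideal.mem_span_singleton_self P
  set Q : Polynomial ℂ := aeval (splitCoeff k d i) P with hQ
  -- At `b = -1` the system has no common zero, since a sum of digits is never `-1`; hence `P` does
  -- not vanish there.
  have hQ0 : Q ≠ 0 := by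
    intro h
    have h1 := eval_aeval_splitCoeff k d i P (-1)
    rw [← hQ, h, Polynomial.eval_zero] at h1
    exact evalCoeffs_ne_zero_of_le_span (splitSystem_isHomogeneous k d i hd (-1))
      (eq_zero_of_eval_splitSystem k d i hd) hP.le h1.symm
  obtain ⟨s, hs, hsv⟩ := exists_digit_values k d i hd
  -- If `b` is the digit sum of `m`, the point with `x_i = 1` and `x_l = m_l` is a common zero of
  -- the system, so `Q` vanishes at `b`. Since `b` enters only the `i`-th form, and linearly, the
  -- degree of `Q` is at most `n`.
  have hroots : (s.map ⟨((↑) : ℕ → ℂ), Nat.cast_injective⟩).val ⊆ Q.roots := by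
    intro b₀ hb₀
    obtain ⟨b, hb, rfl⟩ := Finset.mem_map.1 (show b₀ ∈ s.map _ from hb₀)
    change (b : ℂ) ∈ Q.roots
    obtain ⟨m, hm, hbm⟩ := hsv b hb
    rw [Polynomial.mem_roots hQ0, Polynomial.IsRoot, hQ, eval_aeval_splitCoeff]
    have hx : (fun l => if l = i then (1 : ℂ) else m l) ≠ 0 := fun h => by
      simpa using congrFun h i
    refine aeval_eq_zero_of_mem_inertiaIdeal hmem _ _ hx fun l => ?_
    rw [← eval_eq_formValue (splitSystem_isHomogeneous k d i hd _)]
    by_cases hl : l = i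
    · subst hl
      rw [eval_splitSystem_self, if_pos rfl, one_pow, one_pow, one_mul, mul_one, sub_eq_zero]
      rw [Finset.sum_congr rfl fun j hj => by rw [if_neg (Finset.ne_of_mem_erase hj)]]
      simp [hbm]
    · rw [splitSystem, if_neg hl, eval_splitForm, if_pos rfl, if_neg hl]
      exact Finset.prod_eq_zero (Finset.mem_range.2 (hm l)) (by simp)
  have h1 := Polynomial.card_le_degree_of_subset_roots hroots
  rw [Finset.card_map] at h1
  exact (hs.trans h1).trans (natDegree_aeval_le hn _ (natDegree_splitCoeff_le k d i))

end SplitForms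

/-! ### The resultant -/

theorem minorsGcd_dvd (k d : ℕ)
    (e : Mon k (k * (d - 1) + d) → Fin (k + 1) × Mon k (k * (d - 1))) :
    minorsGcd k d ∣ ((genMacaulay k d (k * (d - 1)) (genericForm k d)).submatrix e id).det := by
  let : NormalizedGCDMonoid (CoeffRing k) := Nonempty.some inferInstance
  exact Finset.gcd_dvd (Finset.mem_univ e)

theorem dvd_minorsGcd {k d : ℕ} {a : CoeffRing k}
    (h : ∀ e, a ∣ ((genMacaulay k d (k * (d - 1)) (genericForm k d)).submatrix e id).det) :
    a ∣ minorsGcd k d := by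
  let : NormalizedGCDMonoid (CoeffRing k) := Nonempty.some inferInstance
  exact Finset.dvd_gcd fun e _ => h e

/-- The gcd is `g = P h` with `P` a generator of the inertia ideal. In each block `deg g ≤ d ^ k ≤
deg P`, so `h` is an integer; as `g` takes a unit value at the power forms, `h` is `±1`. -/
theorem minorsGcd_properties {k d : ℕ} (hd : 1 ≤ d) :
    inertiaIdeal k d = Ideal.span {minorsGcd k d} ∧
    (∀ i, blockScale k i (minorsGcd k d) =
      Polynomial.C (minorsGcd k d) * Polynomial.X ^ (d ^ k)) ∧
    IsUnit (evalCoeffs (fun i => (X i : MvPolynomial (Fin (k + 1)) ℤ) ^ d) (minorsGcd k d)) := by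
  set g := minorsGcd k d with hg
  have hgdvd : ∀ e : Mon k (k * (d - 1) + d) → Fin (k + 1) × Mon k (k * (d - 1)),
      g ∣ ((genMacaulay k d (k * (d - 1)) (genericForm k d)).submatrix e id).det :=
    minorsGcd_dvd k d
  choose e he n hn hen using exists_macaulay_minor (k := k) (d := d)
  set Δ := fun i => ((genMacaulay k d (k * (d - 1)) (genericForm k d)).submatrix (e i) id).det
  have hΔ : ∀ i, Δ i ≠ 0 := by
    intro i h
    have := he i
    change evalCoeffs _ (Δ i) = 1 at this
    rw [h, evalCoeffs, map_zero] at this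
    exact zero_ne_one this
  have hbot : inertiaIdeal k d ≠ ⊥ := by
    intro h
    have := det_macaulay_mem (d := d) (e 0)
    rw [h, Ideal.mem_bot] at this
    exact hΔ 0 this
  obtain ⟨P, hP⟩ := exists_inertiaIdeal_eq_span k d hd hbot
  have hPg : P ∣ g := dvd_minorsGcd fun e =>
    Ideal.mem_span_singleton.1 (hP ▸ det_macaulay_mem (d := d) e)
  obtain ⟨h, hh⟩ := hPg
  have hPΔ : ∀ i, P ∣ Δ i := fun i => (Dvd.intro h hh.symm).trans (hgdvd (e i))
  have hg0 : g ≠ 0 := fun h0 => hΔ 0 (zero_dvd_iff.1 (h0 ▸ hgdvd (e 0)))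
  have hP0 : P ≠ 0 := fun h0 => hg0 (by rw [hh, h0, zero_mul])
  have hh0 : h ≠ 0 := fun h0 => hg0 (by rw [hh, h0, mul_zero])
  have hgn : ∀ i, (blockScale k i g).natDegree ≤ d ^ k := fun i =>
    (natDegree_blockScale_le_of_dvd (hΔ i) (hen i) (hgdvd (e i))).trans (hn i)
  have hPn : ∀ i, d ^ k ≤ (blockScale k i P).natDegree := fun i =>
    pow_le_of_span k d i hd hP (blockScale_of_dvd (hΔ i) (hen i) (hPΔ i))
  have hadd : ∀ i, (blockScale k i g).natDegree =
      (blockScale k i P).natDegree + (blockScale k i h).natDegree := fun i => by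
    rw [hh, map_mul, Polynomial.natDegree_mul (blockScale_ne_zero i hP0)
      (blockScale_ne_zero i hh0)]
  have hhC : h = C (h.coeff 0) := by
    apply eq_C_of_blockScale
    intro i
    have h1 := blockScale_of_dvd (hΔ i) (hen i)
      ((Dvd.intro_left P hh.symm).trans (hgdvd (e i)))
    have h2 : (blockScale k i h).natDegree = 0 := by
      have := hgn i; have := hPn i; have := hadd i
      omega
    rw [h2, pow_zero, mul_one] at h1
    exact h1
  have hgu : IsUnit (evalCoeffs (fun i => (X i : MvPolynomial (Fin (k + 1)) ℤ) ^ d) g) := by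
    apply isUnit_of_dvd_one
    rw [← he 0]
    exact map_dvd (aeval _ : CoeffRing k →ₐ[ℤ] ℤ) (hgdvd (e 0))
  have hhu : IsUnit h := by
    rw [hhC]
    apply IsUnit.map
    rw [hh, evalCoeffs, map_mul] at hgu
    have := isUnit_of_mul_isUnit_right hgu
    rw [hhC] at this
    simpa using this
  refine ⟨?_, fun i => ?_, hgu⟩
  · rw [hP, hh]
    exact (Ideal.span_singleton_mul_right_unit hhu P).symm
  · have h1 := blockScale_of_dvd (hΔ i) (hen i) (hgdvd (e i))
    have h2 : (blockScale k i g).natDegree = d ^ k :=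
      le_antisymm (hgn i) ((hPn i).trans (by rw [hadd i]; omega))
    rw [h2] at h1
    exact h1

theorem exists_universalResultant_eq {k d : ℕ} (hd : 1 ≤ d) :
    ∃ u : ℤ, IsUnit u ∧ universalResultant k d = C u * minorsGcd k d :=
  ⟨_, (minorsGcd_properties hd).2.2, universalResultant.eq_1 k d⟩

theorem inertiaIdeal_eq_span_universalResultant {k d : ℕ} (hd : 1 ≤ d) :
    inertiaIdeal k d = Ideal.span {universalResultant k d} := by
  obtain ⟨u, hu, h⟩ := exists_universalResultant_eq (k := k) hd
  rw [h, Ideal.span_singleton_mul_left_unit (hu.map C), (minorsGcd_properties hd).1]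

theorem universalResultant_mem {k d : ℕ} (hd : 1 ≤ d) :
    universalResultant k d ∈ inertiaIdeal k d := by
  rw [inertiaIdeal_eq_span_universalResultant hd]
  exact Ideal.mem_span_singleton_self _

theorem blockScale_universalResultant {k d : ℕ} (hd : 1 ≤ d) (i : Fin (k + 1)) :
    blockScale k i (universalResultant k d) =
      Polynomial.C (universalResultant k d) * Polynomial.X ^ (d ^ k) := by
  obtain ⟨u, hu, h⟩ := exists_universalResultant_eq (k := k) hd
  have hC : blockScale k i (C u) = Polynomial.C (C u) := by
    simp [blockScale]
  rw [h, map_mul, (minorsGcd_properties hd).2.1 i, hC, map_mul, mul_assoc]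

/-- The resultant of forms without nontrivial common zeros does not vanish. -/
theorem resultant_ne_zero {K : Type*} [Field K] [IsAlgClosed K] {k d : ℕ} (hd : 1 ≤ d)
    {F : Fin (k + 1) → MvPolynomial (Fin (k + 1)) K} (hF : ∀ i, (F i).IsHomogeneous d)
    (h0 : ∀ x, (∀ i, eval x (F i) = 0) → x = 0) : resultant d F ≠ 0 :=
  evalCoeffs_ne_zero_of_le_span hF h0 (inertiaIdeal_eq_span_universalResultant hd).le

theorem aeval_block_mul {R : Type*} [CommRing R] {k d : ℕ} (hd : 1 ≤ d) (i : Fin (k + 1)) (a : R)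
    (c : Fin (k + 1) × (Fin (k + 1) →₀ ℕ) → R) :
    aeval (fun p => c p * a ^ (if p.1 = i then 1 else 0)) (universalResultant k d) =
      aeval c (universalResultant k d) * a ^ (d ^ k) := by
  let f : Polynomial (CoeffRing k) →+* R :=
    Polynomial.eval₂RingHom (aeval c : CoeffRing k →ₐ[ℤ] R).toRingHom a
  have h1 := congrArg f (blockScale_universalResultant (k := k) hd i)
  have h2 := ringHom_eq_aeval (f.comp (blockScale k i : CoeffRing k →+* _)) (universalResultant k d)
  simp only [RingHom.comp_apply, RingHom.coe_coe] at h2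
  rw [h1] at h2
  rw [map_mul, map_pow] at h2
  have h3 : f Polynomial.X = a := by simp [f]
  have h4 : ∀ b, f (Polynomial.C b) = aeval c b := fun b => by simp [f]
  rw [h3, h4] at h2
  rw [h2]
  congr 2
  ext1 p
  rw [blockScale, aeval_X, map_mul, map_pow, h3, h4, aeval_X]

/-- The resultant is homogeneous of degree `(k + 1) d ^ k` in the coefficients. -/
theorem aeval_mul_universalResultant {R : Type*} [CommRing R] {k d : ℕ} (hd : 1 ≤ d) (a : R)
    (c : Fin (k + 1) × (Fin (k + 1) →₀ ℕ) → R) :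
    aeval (fun p => c p * a) (universalResultant k d) =
      aeval c (universalResultant k d) * a ^ ((k + 1) * d ^ k) := by
  classical
  have h : ∀ s : Finset (Fin (k + 1)),
      aeval (fun p => c p * a ^ (if p.1 ∈ s then 1 else 0)) (universalResultant k d) =
        aeval c (universalResultant k d) * a ^ (s.card * d ^ k) := by
    intro s
    induction s using Finset.induction_on with
    | empty => simp
    | insert i s hi ih =>
      rw [Finset.card_insert_of_notMem hi, add_mul, one_mul, pow_add, ← mul_assoc, ← ih,
        ← aeval_block_mul hd i]
      congr 2
      ext1 p
      by_cases h1 : p.1 = i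
      · rw [h1]; simp [hi]
      · simp [h1]
  simpa using h Finset.univ

/-! ### Norms of values of polynomials -/

theorem norm_intCast_le_abs {K : Type*} [NormedField K] (n : ℤ) : ‖(n : K)‖ ≤ |(n : ℝ)| := by
  have h : ∀ m : ℕ, ‖(m : K)‖ ≤ m := fun m => by
    simpa using Nat.norm_cast_le (α := K) m
  obtain ⟨m, rfl | rfl⟩ := n.eq_nat_or_neg
  · simpa using h m
  · simpa using h m

/-- The values of a polynomial with integer coefficients on the unit polydisc are bounded
independently of the normed field, and by `1` over ultrametric fields. -/
theorem exists_norm_aeval_le {σ : Type*} (a : MvPolynomial σ ℤ) :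
    ∃ B : ℝ, 0 ≤ B ∧ ∀ (K : Type u) [NormedField K] (c : σ → K), (∀ p, ‖c p‖ ≤ 1) →
      ‖aeval c a‖ ≤ B ∧ (IsUltrametricDist K → ‖aeval c a‖ ≤ 1) := by
  induction a using MvPolynomial.induction_on with
  | C n =>
    refine ⟨|(n : ℝ)|, abs_nonneg _, fun K _ c hc => ⟨?_, fun _ => ?_⟩⟩
    · simpa using norm_intCast_le_abs (K := K) n
    · simpa using IsUltrametricDist.norm_intCast_le_one K n
  | add p q hp hq =>
    obtain ⟨B, hB, hp⟩ := hp
    obtain ⟨B', hB', hq⟩ := hq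
    refine ⟨B + B', by positivity, fun K _ c hc => ⟨?_, fun _ => ?_⟩⟩
    · rw [map_add]
      exact (norm_add_le _ _).trans (add_le_add (hp K c hc).1 (hq K c hc).1)
    · rw [map_add]
      exact (IsUltrametricDist.norm_add_le_max _ _).trans
        (max_le ((hp K c hc).2 ‹_›) ((hq K c hc).2 ‹_›))
  | mul_X p i hp =>
    obtain ⟨B, hB, hp⟩ := hp
    refine ⟨B, hB, fun K _ c hc => ?_⟩
    rw [map_mul, aeval_X, norm_mul]
    have h := mul_le_of_le_one_right (norm_nonneg (aeval c p)) (hc i)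
    exact ⟨h.trans (hp K c hc).1, fun hu => h.trans ((hp K c hc).2 hu)⟩

theorem exists_norm_eval₂_le {σ τ : Type*} (a : MvPolynomial τ (MvPolynomial σ ℤ)) :
    ∃ B : ℝ, 0 ≤ B ∧ ∀ (K : Type u) [NormedField K] (c : σ → K) (x : τ → K),
      (∀ p, ‖c p‖ ≤ 1) → (∀ l, ‖x l‖ ≤ 1) →
      ‖eval₂Hom (aeval c : MvPolynomial σ ℤ →ₐ[ℤ] K).toRingHom x a‖ ≤ B ∧
      (IsUltrametricDist K →
        ‖eval₂Hom (aeval c : MvPolynomial σ ℤ →ₐ[ℤ] K).toRingHom x a‖ ≤ 1) := by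
  induction a using MvPolynomial.induction_on with
  | C n =>
    obtain ⟨B, hB, h⟩ := exists_norm_aeval_le n
    refine ⟨B, hB, fun K _ c x hc hx => ?_⟩
    rw [eval₂Hom_C]
    exact h K c hc
  | add p q hp hq =>
    obtain ⟨B, hB, hp⟩ := hp
    obtain ⟨B', hB', hq⟩ := hq
    refine ⟨B + B', by positivity, fun K _ c x hc hx => ⟨?_, fun _ => ?_⟩⟩
    · rw [map_add]
      exact (norm_add_le _ _).trans (add_le_add (hp K c x hc hx).1 (hq K c x hc hx).1)
    · rw [map_add]
      exact (IsUltrametricDist.norm_add_le_max _ _).trans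
        (max_le ((hp K c x hc hx).2 ‹_›) ((hq K c x hc hx).2 ‹_›))
  | mul_X p i hp =>
    obtain ⟨B, hB, hp⟩ := hp
    refine ⟨B, hB, fun K _ c x hc hx => ?_⟩
    rw [map_mul, eval₂Hom_X', norm_mul]
    have h := mul_le_of_le_one_right (norm_nonneg
      (eval₂Hom (aeval c : MvPolynomial σ ℤ →ₐ[ℤ] K).toRingHom x p)) (hx i)
    exact ⟨h.trans (hp K c x hc hx).1, fun hu => h.trans ((hp K c x hc hx).2 hu)⟩

theorem coeffNorm_nonneg {K : Type*} [NormedField K] {k d : ℕ}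
    (F : Fin (k + 1) → MvPolynomial (Fin (k + 1)) K) : 0 ≤ coeffNorm norm d F :=
  Real.iSup_nonneg fun _ => norm_nonneg _

theorem norm_coeff_le {K : Type*} [NormedField K] {k d : ℕ}
    (F : Fin (k + 1) → MvPolynomial (Fin (k + 1)) K) (i : Fin (k + 1)) (α : Mon k d) :
    ‖(F i).coeff α‖ ≤ coeffNorm norm d F :=
  le_ciSup (f := fun p : Fin (k + 1) × Mon k d => ‖(F p.1).coeff p.2‖) (Set.finite_range _).bddAbove (i, α)

theorem norm_coeff_le' {K : Type*} [NormedField K] {k d : ℕ}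
    {F : Fin (k + 1) → MvPolynomial (Fin (k + 1)) K} (hF : ∀ i, (F i).IsHomogeneous d)
    (i : Fin (k + 1)) (α : Fin (k + 1) →₀ ℕ) : ‖(F i).coeff α‖ ≤ coeffNorm norm d F := by
  by_cases h : (F i).coeff α = 0
  · rw [h, norm_zero]
    exact coeffNorm_nonneg F
  · have h1 := hF i h
    have h2 : ∑ j, α j = d := by
      rw [← h1, ← Finsupp.degree_eq_sum, Finsupp.degree_eq_weight_one]
      rfl
    exact norm_coeff_le F i ⟨α, mem_mon.2 h2⟩

theorem exists_norm_coeff_eq {K : Type*} [NormedField K] {k d : ℕ}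
    (F : Fin (k + 1) → MvPolynomial (Fin (k + 1)) K) :
    ∃ (i : Fin (k + 1)) (α : Fin (k + 1) →₀ ℕ), ‖(F i).coeff α‖ = coeffNorm norm d F := by
  have : Nonempty (Fin (k + 1) × Mon k d) := ⟨(0, ⟨_, single_mem_mon d 0⟩)⟩
  obtain ⟨p, hp⟩ := exists_eq_ciSup_of_finite
    (f := fun p : Fin (k + 1) × Mon k d => ‖(F p.1).coeff p.2‖)
  exact ⟨p.1, p.2, hp⟩

theorem exists_norm_apply_eq {K : Type*} [NormedField K] {k : ℕ} (x : Fin (k + 1) → K) :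
    ∃ j, ‖x j‖ = ‖x‖ := by
  obtain ⟨j, -, hj⟩ := Finset.exists_max_image Finset.univ (fun j => ‖x j‖) Finset.univ_nonempty
  exact ⟨j, le_antisymm (norm_le_pi_norm x j)
    ((pi_norm_le_iff_of_nonneg (norm_nonneg _)).2 fun i => hj i (Finset.mem_univ i))⟩

/-- The lower bound for the values of a lift in terms of the resultant. -/
theorem exists_norm_resultant_le (k d : ℕ) (hd : 1 ≤ d) :
    ∃ B : ℝ, 1 ≤ B ∧ ∀ (K : Type u) [NormedField K]
      (F : Fin (k + 1) → MvPolynomial (Fin (k + 1)) K), (∀ i, (F i).IsHomogeneous d) →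
      0 < coeffNorm norm d F → ∀ (x : Fin (k + 1) → K),
      coeffNorm norm d F * ‖resultant d F‖ * ‖x‖ ^ d ≤
        B * coeffNorm norm d F ^ ((k + 1) * d ^ k) * ‖evalMap F x‖ ∧
      (IsUltrametricDist K → coeffNorm norm d F * ‖resultant d F‖ * ‖x‖ ^ d ≤
        coeffNorm norm d F ^ ((k + 1) * d ^ k) * ‖evalMap F x‖) := by
  have hA := fun j : Fin (k + 1) => exists_eq_sum_of_chartHom_eq_zero
    ((mem_inertiaIdeal j).1 (universalResultant_mem (k := k) hd))
  choose A hA using hA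
  choose B hB0 hB using fun j i => exists_norm_eval₂_le.{u} (A j i)
  refine ⟨1 + ∑ j, ∑ i, B j i, le_add_of_nonneg_right
    (Finset.sum_nonneg fun j _ => Finset.sum_nonneg fun i _ => hB0 j i), ?_⟩
  intro K _ F hF hpos x
  by_cases hx : x = 0
  · have h0 : ‖x‖ ^ d = 0 := by rw [hx, norm_zero, zero_pow (by omega)]
    rw [h0, mul_zero]
    have := Finset.sum_nonneg fun j (_ : j ∈ Finset.univ) =>
      Finset.sum_nonneg fun i (_ : i ∈ Finset.univ) => hB0 j i
    exact ⟨by positivity, fun _ => by positivity⟩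
  obtain ⟨j, hj⟩ := exists_norm_apply_eq x
  obtain ⟨i₀, α₀, hm⟩ := exists_norm_coeff_eq (d := d) F
  set m := (F i₀).coeff α₀
  have hm0 : m ≠ 0 := norm_pos_iff.1 (by rw [hm]; exact hpos)
  have hxn : 0 < ‖x‖ := norm_pos_iff.2 hx
  have hxj : x j ≠ 0 := norm_pos_iff.1 (by rw [hj]; exact hxn)
  set y := (x j)⁻¹ • x
  have hyj : y j = 1 := by simp [y, hxj]
  have hy : ∀ l, ‖y l‖ ≤ 1 := fun l => by
    simp only [y, Pi.smul_apply, smul_eq_mul, norm_mul, norm_inv, hj]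
    rw [inv_mul_le_one₀ hxn]
    exact norm_le_pi_norm x l
  set c : Fin (k + 1) × (Fin (k + 1) →₀ ℕ) → K := fun p => (F p.1).coeff p.2 * m⁻¹
  have hc : ∀ p, ‖c p‖ ≤ 1 := fun p => by
    simp only [c, norm_mul, norm_inv, hm]
    rw [← div_eq_mul_inv, div_le_one hpos]
    exact norm_coeff_le' hF _ _
  have hval : ∀ i, formValue d c y i = (x j)⁻¹ ^ d * m⁻¹ * eval x (F i) := by
    intro i
    rw [formValue_smul, eval_eq_formValue hF, formValue, formValue, mul_assoc]
    congr 1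
    rw [Finset.mul_sum]
    exact Finset.sum_congr rfl fun α _ => by simp only [c]; ring
  -- The identity of chart `j` evaluated at the normalized data: coefficients divided by one of
  -- maximal size, and coordinates by one of maximal size. Every multiplier `A j i` is then
  -- evaluated inside the unit polydisc.
  have hres : resultant d F * m⁻¹ ^ ((k + 1) * d ^ k) = ∑ i,
      eval₂Hom (aeval c : CoeffRing k →ₐ[ℤ] K).toRingHom y (A j i) *
        ((x j)⁻¹ ^ d * m⁻¹ * eval x (F i)) := by
    have h1 := congrArg (eval₂Hom (aeval c : CoeffRing k →ₐ[ℤ] K).toRingHom y) (hA j)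
    rw [map_sum, eval₂Hom_C] at h1
    simp only [map_mul, eval₂Hom_chartForm c y hyj, hval] at h1
    rw [← h1]
    exact (aeval_mul_universalResultant hd m⁻¹ _).symm
  have hterm : ∀ i, ‖(x j)⁻¹ ^ d * m⁻¹ * eval x (F i)‖ ≤
      (‖x‖ ^ d)⁻¹ * (coeffNorm norm d F)⁻¹ * ‖evalMap F x‖ := fun i => by
    rw [norm_mul, norm_mul, norm_pow, norm_inv, norm_inv, hj, hm, inv_pow]
    exact mul_le_mul_of_nonneg_left (norm_le_pi_norm (evalMap F x) i) (by positivity)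
  set S := (‖x‖ ^ d)⁻¹ * (coeffNorm norm d F)⁻¹ * ‖evalMap F x‖ with hS
  have hS0 : 0 ≤ S := by positivity
  have key : ∀ C : ℝ, ‖resultant d F * m⁻¹ ^ ((k + 1) * d ^ k)‖ ≤ C * S →
      coeffNorm norm d F * ‖resultant d F‖ * ‖x‖ ^ d ≤
        C * coeffNorm norm d F ^ ((k + 1) * d ^ k) * ‖evalMap F x‖ := by
    intro C hC
    rw [norm_mul, norm_pow, norm_inv, hm, inv_pow, ← div_eq_mul_inv,
      div_le_iff₀ (by positivity)] at hC
    calc coeffNorm norm d F * ‖resultant d F‖ * ‖x‖ ^ d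
        ≤ coeffNorm norm d F * (C * S * coeffNorm norm d F ^ ((k + 1) * d ^ k)) * ‖x‖ ^ d := by
          gcongr
      _ = C * coeffNorm norm d F ^ ((k + 1) * d ^ k) * ‖evalMap F x‖ := by
          rw [hS]
          field_simp
  constructor
  · apply key
    rw [hres]
    have h1 : ∀ i, ‖eval₂Hom (aeval c : CoeffRing k →ₐ[ℤ] K).toRingHom y (A j i) *
        ((x j)⁻¹ ^ d * m⁻¹ * eval x (F i))‖ ≤ B j i * S := fun i => by
      rw [norm_mul]
      exact mul_le_mul (hB j i K c y hc hy).1 (hterm i) (norm_nonneg _) (hB0 j i)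
    refine (norm_sum_le _ _).trans ((Finset.sum_le_sum fun i _ => h1 i).trans ?_)
    rw [← Finset.sum_mul]
    refine mul_le_mul_of_nonneg_right ?_ hS0
    have h2 := Finset.single_le_sum (f := fun j => ∑ i, B j i)
      (fun j _ => Finset.sum_nonneg fun i _ => hB0 j i) (Finset.mem_univ j)
    exact h2.trans (by linarith)
  · intro hu
    have := key 1
    rw [one_mul, one_mul] at this
    apply this
    rw [hres]
    refine IsUltrametricDist.norm_sum_le_of_forall_le_of_nonneg hS0 fun i _ => ?_
    rw [norm_mul]
    exact (mul_le_of_le_one_left (norm_nonneg _) ((hB j i K c y hc hy).2 hu)).trans (hterm i)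

/-! ### Upper bounds and Lipschitz estimates for forms -/

/-- Telescoping, one factor at a time. The weights `n i` allow the factors to be powers, so that a
monomial has Lipschitz constant its degree. -/
theorem norm_prod_sub_prod_le {ι K : Type*} [NormedField K] (s : Finset ι) (a b : ι → K)
    (n : ι → ℝ) {δ : ℝ} (ha : ∀ i, ‖a i‖ ≤ 1) (hb : ∀ i, ‖b i‖ ≤ 1)
    (hab : ∀ i, ‖a i - b i‖ ≤ n i * δ) :
    ‖∏ i ∈ s, a i - ∏ i ∈ s, b i‖ ≤ (∑ i ∈ s, n i) * δ := by
  classical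
  induction s using Finset.induction_on with
  | empty => simp
  | insert i s hi ih =>
    rw [Finset.prod_insert hi, Finset.prod_insert hi, Finset.sum_insert hi, add_mul]
    have h : a i * ∏ i ∈ s, a i - b i * ∏ i ∈ s, b i =
        (a i - b i) * ∏ i ∈ s, a i + b i * (∏ i ∈ s, a i - ∏ i ∈ s, b i) := by ring
    have hp : ‖∏ i ∈ s, a i‖ ≤ 1 := by
      rw [norm_prod]
      exact Finset.prod_le_one (fun _ _ => norm_nonneg _) fun i _ => ha i
    rw [h]
    refine (norm_add_le _ _).trans (add_le_add ?_ ?_)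
    · rw [norm_mul]
      exact (mul_le_of_le_one_right (norm_nonneg _) hp).trans (hab i)
    · rw [norm_mul]
      exact (mul_le_of_le_one_left (norm_nonneg _) (hb i)).trans ih

theorem norm_prod_sub_prod_le_of_ultrametric {ι K : Type*} [NormedField K] [IsUltrametricDist K]
    (s : Finset ι) (a b : ι → K) {δ : ℝ} (hδ : 0 ≤ δ) (ha : ∀ i, ‖a i‖ ≤ 1) (hb : ∀ i, ‖b i‖ ≤ 1)
    (hab : ∀ i, ‖a i - b i‖ ≤ δ) : ‖∏ i ∈ s, a i - ∏ i ∈ s, b i‖ ≤ δ := by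
  classical
  induction s using Finset.induction_on with
  | empty => simpa using hδ
  | insert i s hi ih =>
    rw [Finset.prod_insert hi, Finset.prod_insert hi]
    have h : a i * ∏ i ∈ s, a i - b i * ∏ i ∈ s, b i =
        (a i - b i) * ∏ i ∈ s, a i + b i * (∏ i ∈ s, a i - ∏ i ∈ s, b i) := by ring
    have hp : ‖∏ i ∈ s, a i‖ ≤ 1 := by
      rw [norm_prod]
      exact Finset.prod_le_one (fun _ _ => norm_nonneg _) fun i _ => ha i
    rw [h]
    refine (IsUltrametricDist.norm_add_le_max _ _).trans (max_le ?_ ?_)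
    · rw [norm_mul]
      exact (mul_le_of_le_one_right (norm_nonneg _) hp).trans (hab i)
    · rw [norm_mul]
      exact (mul_le_of_le_one_left (norm_nonneg _) (hb i)).trans ih

theorem norm_monomial_sub_le {K : Type*} [NormedField K] {k n : ℕ} (α : Mon k n)
    {x y : Fin (k + 1) → K} (hx : ‖x‖ ≤ 1) (hy : ‖y‖ ≤ 1) :
    ‖∏ j, x j ^ (α : Fin (k + 1) →₀ ℕ) j - ∏ j, y j ^ (α : Fin (k + 1) →₀ ℕ) j‖ ≤ n * ‖x - y‖ ∧
    (IsUltrametricDist K →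
      ‖∏ j, x j ^ (α : Fin (k + 1) →₀ ℕ) j - ∏ j, y j ^ (α : Fin (k + 1) →₀ ℕ) j‖ ≤
        ‖x - y‖) := by
  have hx' : ∀ j, ‖x j‖ ≤ 1 := fun j => (norm_le_pi_norm x j).trans hx
  have hy' : ∀ j, ‖y j‖ ≤ 1 := fun j => (norm_le_pi_norm y j).trans hy
  have hxp : ∀ j, ‖x j ^ (α : Fin (k + 1) →₀ ℕ) j‖ ≤ 1 := fun j => by
    rw [norm_pow]; exact pow_le_one₀ (norm_nonneg _) (hx' j)
  have hyp : ∀ j, ‖y j ^ (α : Fin (k + 1) →₀ ℕ) j‖ ≤ 1 := fun j => by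
    rw [norm_pow]; exact pow_le_one₀ (norm_nonneg _) (hy' j)
  have hxy : ∀ j, ‖x j - y j‖ ≤ ‖x - y‖ := fun j => norm_le_pi_norm (x - y) j
  constructor
  · have h := norm_prod_sub_prod_le Finset.univ (fun j => x j ^ (α : Fin (k + 1) →₀ ℕ) j)
      (fun j => y j ^ (α : Fin (k + 1) →₀ ℕ) j)
      (fun j => (((α : Fin (k + 1) →₀ ℕ) j : ℕ) : ℝ)) (δ := ‖x - y‖) hxp hyp fun j => by
        have := norm_prod_sub_prod_le (Finset.range ((α : Fin (k + 1) →₀ ℕ) j))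
          (fun _ => x j) (fun _ => y j) (fun _ => 1) (δ := ‖x - y‖) (fun _ => hx' j)
          (fun _ => hy' j) (fun _ => by rw [one_mul]; exact hxy j)
        simpa using this
    rw [← Nat.cast_sum, α.sum_eq] at h
    exact h
  · intro _
    refine norm_prod_sub_prod_le_of_ultrametric _ _ _ (norm_nonneg _) hxp hyp fun j => ?_
    have := norm_prod_sub_prod_le_of_ultrametric (Finset.range ((α : Fin (k + 1) →₀ ℕ) j))
      (fun _ => x j) (fun _ => y j) (norm_nonneg (x - y)) (fun _ => hx' j)
      (fun _ => hy' j) (fun _ => hxy j)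
    simpa using this

theorem norm_evalMap_sub_le {K : Type*} [NormedField K] {k d : ℕ}
    {F : Fin (k + 1) → MvPolynomial (Fin (k + 1)) K} (hF : ∀ i, (F i).IsHomogeneous d)
    {x y : Fin (k + 1) → K} (hx : ‖x‖ ≤ 1) (hy : ‖y‖ ≤ 1) :
    ‖evalMap F x - evalMap F y‖ ≤ Fintype.card (Mon k d) * d * coeffNorm norm d F * ‖x - y‖ ∧
    (IsUltrametricDist K → ‖evalMap F x - evalMap F y‖ ≤ coeffNorm norm d F * ‖x - y‖) := by
  have h0 := coeffNorm_nonneg (d := d) F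
  have hdiff : ∀ i, (evalMap F x - evalMap F y) i = ∑ α : Mon k d, (F i).coeff α *
      (∏ j, x j ^ (α : Fin (k + 1) →₀ ℕ) j - ∏ j, y j ^ (α : Fin (k + 1) →₀ ℕ) j) := by
    intro i
    simp only [Pi.sub_apply, evalMap, eval_eq_formValue hF, formValue, mul_sub,
      Finset.sum_sub_distrib]
  constructor
  · refine (pi_norm_le_iff_of_nonneg (by positivity)).2 fun i => ?_
    rw [hdiff]
    refine (norm_sum_le _ _).trans ?_
    refine (Finset.sum_le_card_nsmul _ _ (coeffNorm norm d F * (d * ‖x - y‖)) fun α _ => ?_).trans ?_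
    · rw [norm_mul]
      exact mul_le_mul (norm_coeff_le F i α) (norm_monomial_sub_le α hx hy).1 (norm_nonneg _) h0
    · rw [nsmul_eq_mul, Finset.card_univ]
      exact le_of_eq (by ring)
  · intro hu
    refine (pi_norm_le_iff_of_nonneg (by positivity)).2 fun i => ?_
    rw [hdiff]
    refine IsUltrametricDist.norm_sum_le_of_forall_le_of_nonneg (by positivity) fun α _ => ?_
    rw [norm_mul]
    exact mul_le_mul (norm_coeff_le F i α) ((norm_monomial_sub_le α hx hy).2 hu)
      (norm_nonneg _) h0

theorem norm_evalMap_le {K : Type*} [NormedField K] {k d : ℕ}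
    {F : Fin (k + 1) → MvPolynomial (Fin (k + 1)) K} (hF : ∀ i, (F i).IsHomogeneous d)
    (x : Fin (k + 1) → K) :
    ‖evalMap F x‖ ≤ Fintype.card (Mon k d) * coeffNorm norm d F * ‖x‖ ^ d ∧
    (IsUltrametricDist K → ‖evalMap F x‖ ≤ coeffNorm norm d F * ‖x‖ ^ d) := by
  have h0 := coeffNorm_nonneg (d := d) F
  have hterm : ∀ (i) (α : Mon k d), ‖(F i).coeff α * ∏ j, x j ^ (α : Fin (k + 1) →₀ ℕ) j‖ ≤
      coeffNorm norm d F * ‖x‖ ^ d := by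
    intro i α
    rw [norm_mul, norm_prod]
    refine mul_le_mul (norm_coeff_le F i α) ?_ (by positivity) h0
    conv_rhs => rw [← α.sum_eq, ← Finset.prod_pow_eq_pow_sum]
    refine Finset.prod_le_prod (fun _ _ => norm_nonneg _) fun j _ => ?_
    rw [norm_pow]
    exact pow_le_pow_left₀ (norm_nonneg _) (norm_le_pi_norm x j) _
  constructor
  · refine (pi_norm_le_iff_of_nonneg (by positivity)).2 fun i => ?_
    rw [evalMap, eval_eq_formValue hF, formValue]
    refine (norm_sum_le _ _).trans ((Finset.sum_le_card_nsmul _ _ _ fun α _ => hterm i α).trans ?_)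
    rw [nsmul_eq_mul, Finset.card_univ]
    exact le_of_eq (by ring)
  · intro hu
    refine (pi_norm_le_iff_of_nonneg (by positivity)).2 fun i => ?_
    rw [evalMap, eval_eq_formValue hF, formValue]
    exact IsUltrametricDist.norm_sum_le_of_forall_le_of_nonneg (by positivity) fun α _ => hterm i α

/-! ### The chordal distance -/

theorem norm_sub_le_max_norm {S : Type*} [SeminormedAddCommGroup S] [IsUltrametricDist S] (x y : S) :
    ‖x - y‖ ≤ max ‖x‖ ‖y‖ := by
  rw [sub_eq_add_neg]
  simpa using IsUltrametricDist.norm_add_le_max x (-y)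


section Chordal

variable {K : Type*} [NormedField K] {k : ℕ}

theorem chordalDist_nonneg (z w : ℙ K (Fin (k + 1) → K)) : 0 ≤ chordalDist z w :=
  div_nonneg (Real.iSup_nonneg fun _ => norm_nonneg _) (by positivity)

theorem chordalDist_mk_le {x y : Fin (k + 1) → K} (hx : x ≠ 0) (hy : y ≠ 0) {C : ℝ}
    (h : ∀ i j, ‖x i * y j - x j * y i‖ ≤ C * (‖x‖ * ‖y‖)) :
    chordalDist (Projectivization.mk K x hx) (Projectivization.mk K y hy) ≤ C := by
  rw [chordalDist_mk, div_le_iff₀ (mul_pos (norm_pos_iff.2 hx) (norm_pos_iff.2 hy))]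
  exact ciSup_le fun p => h p.1 p.2

theorem norm_minor_le {x y : Fin (k + 1) → K} (hx : x ≠ 0) (hy : y ≠ 0) (i j : Fin (k + 1)) :
    ‖x i * y j - x j * y i‖ ≤
      chordalDist (Projectivization.mk K x hx) (Projectivization.mk K y hy) * (‖x‖ * ‖y‖) := by
  rw [chordalDist_mk, div_mul_cancel₀ _
    (mul_pos (norm_pos_iff.2 hx) (norm_pos_iff.2 hy)).ne']
  exact le_ciSup (f := fun p : Fin (k + 1) × Fin (k + 1) => ‖x p.1 * y p.2 - x p.2 * y p.1‖)
    (Set.finite_range _).bddAbove (i, j)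

theorem norm_apply_mul_le (x y : Fin (k + 1) → K) (i j : Fin (k + 1)) :
    ‖x i * y j‖ ≤ ‖x‖ * ‖y‖ := by
  rw [norm_mul]
  exact mul_le_mul (norm_le_pi_norm x i) (norm_le_pi_norm y j) (norm_nonneg _) (norm_nonneg _)

theorem chordalDist_le_two (z w : ℙ K (Fin (k + 1) → K)) : chordalDist z w ≤ 2 := by
  induction z using Projectivization.ind with | h x hx => ?_
  induction w using Projectivization.ind with | h y hy => ?_
  refine chordalDist_mk_le hx hy fun i j => (norm_sub_le _ _).trans ?_
  have h1 := norm_apply_mul_le x y i j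
  have h2 := norm_apply_mul_le x y j i
  linarith

theorem chordalDist_le_one [IsUltrametricDist K] (z w : ℙ K (Fin (k + 1) → K)) :
    chordalDist z w ≤ 1 := by
  induction z using Projectivization.ind with | h x hx => ?_
  induction w using Projectivization.ind with | h y hy => ?_
  refine chordalDist_mk_le hx hy fun i j => (norm_sub_le_max_norm _ _).trans ?_
  rw [one_mul]
  exact max_le (norm_apply_mul_le x y i j) (norm_apply_mul_le x y j i)

theorem chordalDist_mk_le_norm_sub {x y : Fin (k + 1) → K} (hx : x ≠ 0) (hy : y ≠ 0) :
    chordalDist (Projectivization.mk K x hx) (Projectivization.mk K y hy) ≤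
      2 * (‖x - y‖ / ‖x‖) ∧
    (IsUltrametricDist K →
      chordalDist (Projectivization.mk K x hx) (Projectivization.mk K y hy) ≤ ‖x - y‖ / ‖x‖) := by
  have hx0 : ‖x‖ ≠ 0 := norm_ne_zero_iff.2 hx
  have hm : ∀ i j, x i * y j - x j * y i = (x - y) i * y j - (x - y) j * y i := fun i j => by
    simp only [Pi.sub_apply]; ring
  constructor
  · refine chordalDist_mk_le hx hy fun i j => ?_
    rw [hm]
    have h1 := norm_apply_mul_le (x - y) y i j
    have h2 := norm_apply_mul_le (x - y) y j i
    have h3 : 2 * (‖x - y‖ / ‖x‖) * (‖x‖ * ‖y‖) = 2 * (‖x - y‖ * ‖y‖) := by field_simp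
    rw [h3]
    exact (norm_sub_le _ _).trans (by linarith)
  · intro _
    refine chordalDist_mk_le hx hy fun i j => ?_
    rw [hm]
    have h3 : (‖x - y‖ / ‖x‖) * (‖x‖ * ‖y‖) = ‖x - y‖ * ‖y‖ := by field_simp
    rw [h3]
    exact (norm_sub_le_max_norm _ _).trans
      (max_le (norm_apply_mul_le (x - y) y i j) (norm_apply_mul_le (x - y) y j i))

theorem exists_normalized (z : ℙ K (Fin (k + 1) → K)) :
    ∃ (x : Fin (k + 1) → K) (hx : x ≠ 0) (j : Fin (k + 1)),
      z = Projectivization.mk K x hx ∧ x j = 1 ∧ ‖x‖ = 1 := by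
  induction z using Projectivization.ind with | h x hx => ?_
  obtain ⟨j, hj⟩ := exists_norm_apply_eq x
  have hxj : x j ≠ 0 := norm_ne_zero_iff.1 (by rw [hj]; exact norm_ne_zero_iff.2 hx)
  refine ⟨(x j)⁻¹ • x, smul_ne_zero (inv_ne_zero hxj) hx, j, ?_, by simp [hxj], ?_⟩
  · rw [Projectivization.mk_eq_mk_iff']
    exact ⟨x j, by rw [smul_smul, mul_inv_cancel₀ hxj, one_smul]⟩
  · rw [norm_smul, norm_inv, hj, inv_mul_cancel₀ (norm_ne_zero_iff.2 hx)]

/-- Two points have homogeneous coordinates whose difference is bounded by their distance. -/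
theorem exists_close_lifts (z w : ℙ K (Fin (k + 1) → K)) :
    ∃ (x y : Fin (k + 1) → K) (hy : y ≠ 0), w = Projectivization.mk K y hy ∧ ‖y‖ = 1 ∧ ‖x‖ ≤ 1 ∧
      ‖x - y‖ ≤ chordalDist z w ∧ ∀ hx : x ≠ 0, z = Projectivization.mk K x hx := by
  obtain ⟨x, hx, j, hzx, hxj, hx1⟩ := exists_normalized z
  obtain ⟨y, hy, l, hwy, hyl, hy1⟩ := exists_normalized w
  -- As `x j = 1`, the `i`-th coordinate of `y j • x - y` is the minor `x_i y_j - x_j y_i`. The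
  -- vector `y j • x` may vanish when the points are far apart, so it represents `z` only
  -- conditionally.
  refine ⟨y j • x, y, hy, hwy, hy1, ?_, ?_, ?_⟩
  · rw [norm_smul, hx1, mul_one, ← hy1]
    exact norm_le_pi_norm y j
  · refine (pi_norm_le_iff_of_nonneg (chordalDist_nonneg z w)).2 fun i => ?_
    have h := norm_minor_le hx hy i j
    rw [← hzx, ← hwy, hx1, hy1, mul_one, mul_one, hxj, one_mul] at h
    simpa [mul_comm] using h
  · intro hne
    have hyj : y j ≠ 0 := fun h => hne (by rw [h, zero_smul])
    rw [hzx, Projectivization.mk_eq_mk_iff']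
    exact ⟨(y j)⁻¹, by rw [smul_smul, inv_mul_cancel₀ hyj, one_smul]⟩

end Chordal

/-! ### One step of the dynamics -/

theorem abs_log_sub_log_le {s t m : ℝ} (hm : 0 < m) (hs : m ≤ s) (ht : m ≤ t) :
    |log s - log t| ≤ |s - t| / m := by
  have key : ∀ {s t : ℝ}, m ≤ s → m ≤ t → log s - log t ≤ |s - t| / m := by
    intro s t hs ht
    have hs0 := hm.trans_le hs
    have ht0 := hm.trans_le ht
    rw [← Real.log_div hs0.ne' ht0.ne']
    refine (Real.log_le_sub_one_of_pos (div_pos hs0 ht0)).trans ?_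
    rw [div_sub_one ht0.ne']
    calc (s - t) / t ≤ |s - t| / t := div_le_div_of_nonneg_right (le_abs_self _) ht0.le
      _ ≤ |s - t| / m := div_le_div_of_nonneg_left (abs_nonneg _) hm ht
  rw [abs_le]
  refine ⟨?_, key hs ht⟩
  have := key ht hs
  rw [abs_sub_comm] at this
  linarith

section Step

variable {K : Type*} [NormedField K] {k d : ℕ} {F : Fin (k + 1) → MvPolynomial (Fin (k + 1)) K}
  {f : ℙ K (Fin (k + 1) → K) → ℙ K (Fin (k + 1) → K)} {a b ℓ : ℝ}

theorem potential_mem_Icc (hd : 1 ≤ d) (hF : IsLift d F f) (ha : 0 < a)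
    (hlow : ∀ x, a * ‖x‖ ^ d ≤ ‖evalMap F x‖) (hup : ∀ x, ‖evalMap F x‖ ≤ b * ‖x‖ ^ d)
    (z : ℙ K (Fin (k + 1) → K)) :
    potential d F z ∈ Set.Icc (1 / d * log a) (1 / d * log b) := by
  obtain ⟨x, hx, j, rfl, -, hx1⟩ := exists_normalized z
  have h1 := hlow x
  have h2 := hup x
  rw [hx1, one_pow, mul_one] at h1 h2
  rw [potential_mk (by omega) hF, hx1, Real.log_one, sub_zero]
  have hd0 : (0 : ℝ) ≤ 1 / d := by positivity
  exact ⟨mul_le_mul_of_nonneg_left (Real.log_le_log ha h1) hd0,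
    mul_le_mul_of_nonneg_left (Real.log_le_log (ha.trans_le h1) h2) hd0⟩

theorem abs_potential_sub_le (hd : 1 ≤ d) (hF : IsLift d F f) (ha : 0 < a)
    (hlow : ∀ x, a * ‖x‖ ^ d ≤ ‖evalMap F x‖) (hup : ∀ x, ‖evalMap F x‖ ≤ b * ‖x‖ ^ d)
    (z w : ℙ K (Fin (k + 1) → K)) :
    |potential d F z - potential d F w| ≤ 1 / d * (log b - log a) := by
  have h1 := potential_mem_Icc hd hF ha hlow hup z
  have h2 := potential_mem_Icc hd hF ha hlow hup w
  rw [abs_le, mul_sub]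
  constructor <;> linarith [h1.1, h1.2, h2.1, h2.2]

theorem summable_potential (hd : 2 ≤ d) (hF : IsLift d F f) (ha : 0 < a)
    (hlow : ∀ x, a * ‖x‖ ^ d ≤ ‖evalMap F x‖) (hup : ∀ x, ‖evalMap F x‖ ≤ b * ‖x‖ ^ d)
    (z : ℙ K (Fin (k + 1) → K)) :
    Summable fun j : ℕ => potential d F (f^[j] z) / (d : ℝ) ^ j := by
  have hd' : (2 : ℝ) ≤ d := by exact_mod_cast hd
  have hgeo : Summable fun j : ℕ => max |1 / d * log a| |1 / d * log b| * ((d : ℝ)⁻¹) ^ j :=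
    (summable_geometric_of_lt_one (by positivity) (inv_lt_one_of_one_lt₀ (by linarith))).mul_left _
  refine Summable.of_norm_bounded hgeo fun j => ?_
  have h := potential_mem_Icc (by omega) hF ha hlow hup (f^[j] z)
  rw [Real.norm_eq_abs, abs_div, abs_of_pos (show (0 : ℝ) < (d : ℝ) ^ j by positivity),
    div_eq_mul_inv, inv_pow]
  refine mul_le_mul_of_nonneg_right ?_ (by positivity)
  exact abs_le_max_abs_abs h.1 h.2

/-- At distance at most `1/2` there are lifts of norm between `1/2` and `1` differing by at most
that distance, and on them `‖F‖ ≥ a / 2 ^ d` pointwise. At larger distance the summand `4` already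
exceeds the diameter bound `2`. The field may be any normed field. -/
theorem step_of_normed (hd : 1 ≤ d) (hF : IsLift d F f) (ha : 0 < a)
    (hlow : ∀ x, a * ‖x‖ ^ d ≤ ‖evalMap F x‖)
    (hlip : ∀ x y, ‖x‖ ≤ 1 → ‖y‖ ≤ 1 → ‖evalMap F x - evalMap F y‖ ≤ ℓ * ‖x - y‖)
    (hℓ : 0 ≤ ℓ) (z w : ℙ K (Fin (k + 1) → K)) :
    chordalDist (f z) (f w) ≤ (4 + 2 ^ (d + 1) * (ℓ / a)) * chordalDist z w ∧
    (chordalDist z w ≤ 1 / 2 →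
      |potential d F z - potential d F w| ≤ (2 + 2 ^ d * (ℓ / a)) * chordalDist z w) := by
  have hδ := chordalDist_nonneg z w
  by_cases hδ2 : chordalDist z w ≤ 1 / 2
  swap
  · refine ⟨?_, fun h => absurd h hδ2⟩
    push Not at hδ2
    have h1 := chordalDist_le_two (f z) (f w)
    have h2 : 0 ≤ 2 ^ (d + 1) * (ℓ / a) * chordalDist z w := by positivity
    rw [add_mul]
    linarith
  obtain ⟨x, y, hy, hwy, hy1, hx1, hxy, hzx⟩ := exists_close_lifts z w
  have hxn : 1 - chordalDist z w ≤ ‖x‖ := by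
    have := norm_sub_norm_le y x
    rw [norm_sub_rev, hy1] at this
    linarith
  have hx2 : 1 / 2 ≤ ‖x‖ := by linarith
  have hx : x ≠ 0 := norm_pos_iff.1 (by linarith)
  have hz := hzx hx
  obtain ⟨hFx, hfx⟩ := hF.map_mk x hx
  obtain ⟨hFy, hfy⟩ := hF.map_mk y hy
  have hFxl : a * (1 / 2) ^ d ≤ ‖evalMap F x‖ := le_trans (by gcongr) (hlow x)
  have hFyl : a * (1 / 2) ^ d ≤ ‖evalMap F y‖ :=
    le_trans (mul_le_mul_of_nonneg_left (pow_le_pow_left₀ (by norm_num) (by rw [hy1]; norm_num) _)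
      ha.le) (hlow y)
  have hpos : 0 < a * (1 / 2) ^ d := by positivity
  have hdF : ‖evalMap F x - evalMap F y‖ ≤ ℓ * chordalDist z w :=
    (hlip x y hx1 hy1.le).trans (mul_le_mul_of_nonneg_left hxy hℓ)
  have hquot : ℓ * chordalDist z w / (a * (1 / 2) ^ d) = 2 ^ d * (ℓ / a) * chordalDist z w := by
    rw [one_div, inv_pow]
    field_simp
  constructor
  · have h1 := (chordalDist_mk_le_norm_sub hFx hFy).1
    rw [← hfx, ← hfy, ← hz, ← hwy] at h1
    have h2 : ‖evalMap F x - evalMap F y‖ / ‖evalMap F x‖ ≤ 2 ^ d * (ℓ / a) * chordalDist z w := by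
      rw [← hquot]
      gcongr
    have h3 : (4 + 2 ^ (d + 1) * (ℓ / a)) * chordalDist z w =
        4 * chordalDist z w + 2 * (2 ^ d * (ℓ / a) * chordalDist z w) := by ring
    rw [h3]
    linarith
  · intro _
    have hpz : potential d F z = 1 / d * log ‖evalMap F x‖ - log ‖x‖ := by
      rw [hz, potential_mk (by omega) hF]
    have hpw : potential d F w = 1 / d * log ‖evalMap F y‖ - log ‖y‖ := by
      rw [hwy, potential_mk (by omega) hF]
    have h1 := abs_log_sub_log_le hpos hFxl hFyl
    have h2 := abs_log_sub_log_le (show (0 : ℝ) < 1 / 2 by norm_num) hx2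
      (show 1 / 2 ≤ ‖y‖ by rw [hy1]; norm_num)
    have h3 : |‖evalMap F x‖ - ‖evalMap F y‖| / (a * (1 / 2) ^ d) ≤
        2 ^ d * (ℓ / a) * chordalDist z w := by
      rw [← hquot]
      gcongr
      exact (abs_norm_sub_norm_le _ _).trans hdF
    have h4 : |‖x‖ - ‖y‖| / (1 / 2) ≤ 2 * chordalDist z w := by
      have := (abs_norm_sub_norm_le x y).trans hxy
      rw [div_le_iff₀ (by norm_num)]
      linarith
    have h5 : (1 : ℝ) / d ≤ 1 := by
      rw [div_le_one (by exact_mod_cast hd)]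
      exact_mod_cast hd
    have h6 : potential d F z - potential d F w =
        1 / d * (log ‖evalMap F x‖ - log ‖evalMap F y‖) - (log ‖x‖ - log ‖y‖) := by
      rw [hpz, hpw]; ring
    rw [h6]
    refine (abs_sub _ _).trans ?_
    rw [abs_mul, abs_of_nonneg (show (0 : ℝ) ≤ 1 / d by positivity)]
    have h7 := mul_le_of_le_one_left (abs_nonneg (log ‖evalMap F x‖ - log ‖evalMap F y‖)) h5
    rw [add_mul]
    linarith

/-- At distance less than `1` both lifts have norm exactly `1`. If moreover `F(x)` and `F(y)` differ
by less than the lower bound `a`, the ultrametric inequality forces them to have equal norms. -/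
theorem step_of_ultrametric [IsUltrametricDist K] (hd : 1 ≤ d) (hF : IsLift d F f) (ha : 0 < a)
    (hlow : ∀ x, a * ‖x‖ ^ d ≤ ‖evalMap F x‖)
    (hlip : ∀ x y, ‖x‖ ≤ 1 → ‖y‖ ≤ 1 → ‖evalMap F x - evalMap F y‖ ≤ ℓ * ‖x - y‖)
    (hℓ : a ≤ ℓ) (z w : ℙ K (Fin (k + 1) → K)) :
    chordalDist (f z) (f w) ≤ ℓ / a * chordalDist z w ∧
    (chordalDist z w < a / ℓ → potential d F z = potential d F w) := by
  have hδ := chordalDist_nonneg z w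
  have hℓ0 : 0 < ℓ := ha.trans_le hℓ
  have hle : a / ℓ ≤ 1 := (div_le_one hℓ0).2 hℓ
  by_cases hδ2 : chordalDist z w < 1
  swap
  · refine ⟨?_, fun h => absurd (h.trans_le hle) hδ2⟩
    push Not at hδ2
    exact (chordalDist_le_one (f z) (f w)).trans
      (one_le_mul_of_one_le_of_one_le ((one_le_div ha).2 hℓ) hδ2)
  obtain ⟨x, y, hy, hwy, hy1, hx1, hxy, hzx⟩ := exists_close_lifts z w
  have hxn : ‖x‖ = 1 := by
    obtain ⟨j, hj⟩ := exists_norm_apply_eq y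
    refine le_antisymm hx1 ?_
    have h1 : ‖(x - y) j‖ < ‖y j‖ := by
      rw [hj, hy1]
      exact ((norm_le_pi_norm (x - y) j).trans hxy).trans_lt hδ2
    have h2 : ‖x j‖ = ‖y j‖ := by
      have := IsUltrametricDist.norm_add_eq_max_of_norm_ne_norm h1.ne
      rw [max_eq_right h1.le, Pi.sub_apply, sub_add_cancel] at this
      exact this
    rw [← hy1, ← hj, ← h2]
    exact norm_le_pi_norm x j
  have hx : x ≠ 0 := norm_pos_iff.1 (by rw [hxn]; exact one_pos)
  have hz := hzx hx
  obtain ⟨hFx, hfx⟩ := hF.map_mk x hx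
  obtain ⟨hFy, hfy⟩ := hF.map_mk y hy
  have hFxl : a ≤ ‖evalMap F x‖ := by
    have := hlow x
    rwa [hxn, one_pow, mul_one] at this
  have hdF : ‖evalMap F x - evalMap F y‖ ≤ ℓ * chordalDist z w :=
    (hlip x y hx1 hy1.le).trans (mul_le_mul_of_nonneg_left hxy hℓ0.le)
  constructor
  · have h1 := (chordalDist_mk_le_norm_sub hFx hFy).2 inferInstance
    rw [← hfx, ← hfy, ← hz, ← hwy] at h1
    refine h1.trans ?_
    rw [div_mul_eq_mul_div]
    gcongr
  · intro h
    have h1 : ‖evalMap F x - evalMap F y‖ < a := by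
      refine hdF.trans_lt ?_
      rw [lt_div_iff₀ hℓ0] at h
      linarith
    have h2 : ‖evalMap F x‖ = ‖evalMap F y‖ := by
      refine le_antisymm ?_ ?_
      · refine (pi_norm_le_iff_of_nonneg (norm_nonneg _)).2 fun i => ?_
        have h3 : a ≤ ‖evalMap F y‖ := by
          have := hlow y
          rwa [hy1, one_pow, mul_one] at this
        have h4 : evalMap F x i = (evalMap F x - evalMap F y) i + evalMap F y i := by
          rw [Pi.sub_apply, sub_add_cancel]
        rw [h4]
        exact (IsUltrametricDist.norm_add_le_max _ _).trans
          (max_le ((norm_le_pi_norm _ i).trans (h1.le.trans h3)) (norm_le_pi_norm _ i))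
      · refine (pi_norm_le_iff_of_nonneg (norm_nonneg _)).2 fun i => ?_
        have h4 : evalMap F y i = evalMap F x i - (evalMap F x - evalMap F y) i := by
          rw [Pi.sub_apply, sub_sub_cancel]
        rw [h4]
        exact (norm_sub_le_max_norm _ _).trans
          (max_le (norm_le_pi_norm _ i) ((norm_le_pi_norm _ i).trans (h1.le.trans hFxl)))
    rw [hz, hwy, potential_mk (by omega) hF, potential_mk (by omega) hF, h2, hxn, hy1]

end Step

/-! ### Hölder estimate for geometric sums along orbits -/

/-- Let `n` be the first time with `Λ ^ n δ₀ ≥ Λ⁻²`. Earlier terms form a geometric sum of ratio `Λ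
/ d ≥ 2`, or vanish if `E = 0`; later terms are bounded by `A d ^ (-j)`. Both parts are `O(d ^
(-n))`, and `Λ ^ α = d` turns this into `δ₀ ^ α`. The square in the threshold leaves `E / Λ` rather
than `E` in the constant, which stays bounded when `E = Λ`. -/
theorem abs_tsum_sub_tsum_le {d Λ E A α : ℝ} (hd : 2 ≤ d) (hΛ : 1 < Λ) (hE0 : 0 ≤ E)
    (hE : E = 0 ∨ 2 * d ≤ Λ) (hα : Λ ^ α = d) {u v δ : ℕ → ℝ} (hA : ∀ j, |u j - v j| ≤ A)
    (hδ : ∀ j, 0 ≤ δ j) (hstep : ∀ j, δ (j + 1) ≤ Λ * δ j)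
    (hloc : ∀ j, δ j < (Λ ^ 2)⁻¹ → |u j - v j| ≤ E * δ j)
    (hu : Summable fun j => u j / d ^ j) (hv : Summable fun j => v j / d ^ j) :
    |∑' j, u j / d ^ j - ∑' j, v j / d ^ j| ≤ (E / Λ + 2 * A) * d ^ 2 * δ 0 ^ α := by
  have hd0 : 0 < d := by linarith
  have hΛ0 : 0 < Λ := by linarith
  have hA0 : 0 ≤ A := (abs_nonneg _).trans (hA 0)
  rw [← hu.tsum_sub hv]
  have hw : ∀ j, |u j / d ^ j - v j / d ^ j| = |u j - v j| / d ^ j := fun j => by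
    rw [← sub_div, abs_div, abs_of_pos (pow_pos hd0 j)]
  have hδj : ∀ j, δ j ≤ Λ ^ j * δ 0 := by
    intro j
    induction j with
    | zero => simp
    | succ j ih =>
      calc δ (j + 1) ≤ Λ * δ j := hstep j
        _ ≤ Λ * (Λ ^ j * δ 0) := mul_le_mul_of_nonneg_left ih hΛ0.le
        _ = Λ ^ (j + 1) * δ 0 := by ring
  -- If `δ 0 = 0`, no cutting time exists, but then all the `δ j` and all the differences vanish.
  rcases (hδ 0).eq_or_lt with h0 | h0
  · have hzero : ∀ j, u j / d ^ j - v j / d ^ j = 0 := by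
      intro j
      have h1 : δ j = 0 := le_antisymm (by simpa [← h0] using hδj j) (hδ j)
      have h2 := hloc j (by rw [h1]; positivity)
      rw [h1, mul_zero] at h2
      rw [← abs_eq_zero, hw, le_antisymm h2 (abs_nonneg _), zero_div]
    simp only [hzero, tsum_zero, abs_zero]
    have := Real.rpow_nonneg (hδ 0) α
    positivity
  have hex : ∃ n : ℕ, (Λ ^ 2)⁻¹ ≤ Λ ^ n * δ 0 := by
    obtain ⟨n, hn⟩ := pow_unbounded_of_one_lt ((Λ ^ 2)⁻¹ / δ 0) hΛ
    exact ⟨n, ((div_lt_iff₀ h0).1 hn).le⟩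
  classical
  set n := Nat.find hex with hn
  have hn1 : (Λ ^ 2)⁻¹ ≤ Λ ^ n * δ 0 := Nat.find_spec hex
  have hn2 : ∀ m < n, Λ ^ m * δ 0 < (Λ ^ 2)⁻¹ := fun m hm => not_le.1 (Nat.find_min hex hm)
  rw [← (hu.sub hv).sum_add_tsum_nat_add n]
  have htail : |∑' j, (u (j + n) / d ^ (j + n) - v (j + n) / d ^ (j + n))| ≤ 2 * A / d ^ n := by
    have hg : HasSum (fun j : ℕ => A / d ^ n * (1 / 2) ^ j) (A / d ^ n * 2) :=
      hasSum_geometric_two.mul_left _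
    have := tsum_of_norm_bounded hg (f := fun j => u (j + n) / d ^ (j + n) -
      v (j + n) / d ^ (j + n)) fun j => ?_
    · rw [Real.norm_eq_abs] at this
      exact this.trans (le_of_eq (by ring))
    · rw [Real.norm_eq_abs, hw, pow_add, one_div, inv_pow, ← div_eq_mul_inv, div_div,
        mul_comm (d ^ n)]
      have h2 : (2 : ℝ) ^ j ≤ d ^ j := pow_le_pow_left₀ (by norm_num) hd j
      exact div_le_div₀ hA0 (hA _) (by positivity)
        (mul_le_mul_of_nonneg_right h2 (by positivity))
  have hhead : |∑ j ∈ Finset.range n, (u j / d ^ j - v j / d ^ j)| ≤ E / Λ / d ^ n := by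
    have h1 : |∑ j ∈ Finset.range n, (u j / d ^ j - v j / d ^ j)| ≤
        ∑ j ∈ Finset.range n, E * δ 0 * (Λ / d) ^ j := by
      refine (Finset.abs_sum_le_sum_abs _ _).trans (Finset.sum_le_sum fun j hj => ?_)
      rw [hw, div_pow, mul_div_assoc']
      refine div_le_div_of_nonneg_right ?_ (by positivity)
      refine (hloc j ((hδj j).trans_lt (hn2 j (Finset.mem_range.1 hj)))).trans ?_
      calc E * δ j ≤ E * (Λ ^ j * δ 0) := mul_le_mul_of_nonneg_left (hδj j) hE0
        _ = E * δ 0 * Λ ^ j := by ring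
    rw [← Finset.mul_sum] at h1
    rcases hE with hE | hE
    · rw [hE, zero_mul, zero_mul] at h1
      rw [hE, zero_div, zero_div]
      exact h1
    have hr : 2 ≤ Λ / d := (le_div_iff₀ hd0).2 hE
    have hgeom : ∀ m : ℕ, ∑ j ∈ Finset.range m, (Λ / d) ^ j ≤ (Λ / d) ^ m := by
      intro m
      induction m with
      | zero => simp
      | succ m ih =>
        rw [Finset.sum_range_succ, pow_succ]
        have : 0 ≤ (Λ / d) ^ m := by positivity
        nlinarith
    rcases n.eq_zero_or_pos with hn0 | hn0
    · rw [hn0, Finset.range_zero, Finset.sum_empty, abs_zero]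
      positivity
    · have h2 := hn2 (n - 1) (by omega)
      refine h1.trans ((mul_le_mul_of_nonneg_left (hgeom n) (by positivity)).trans ?_)
      rw [div_pow, mul_div_assoc']
      refine div_le_div_of_nonneg_right ?_ (by positivity)
      calc E * δ 0 * Λ ^ n = E * Λ * (Λ ^ (n - 1) * δ 0) := by
            conv_lhs => rw [← Nat.sub_add_cancel hn0, pow_succ]
            ring
        _ ≤ E * Λ * (Λ ^ 2)⁻¹ := mul_le_mul_of_nonneg_left h2.le (by positivity)
        _ = E / Λ := by field_simp
  have hα0 : 0 < α := by
    by_contra! h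
    have := Real.rpow_le_one_of_one_le_of_nonpos hΛ.le h
    rw [hα] at this
    linarith
  have hdn : 1 / d ^ n ≤ d ^ 2 * δ 0 ^ α := by
    have h1 : (Λ ^ (n + 2))⁻¹ ≤ δ 0 := by
      rw [inv_le_iff_one_le_mul₀ (by positivity)]
      rw [inv_le_iff_one_le_mul₀ (by positivity)] at hn1
      exact hn1.trans (le_of_eq (by ring))
    have h2 : ((Λ ^ (n + 2))⁻¹) ^ α ≤ δ 0 ^ α :=
      Real.rpow_le_rpow (by positivity) h1 hα0.le
    rw [Real.inv_rpow (by positivity), ← Real.rpow_natCast Λ, ← Real.rpow_mul hΛ0.le,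
      mul_comm, Real.rpow_mul hΛ0.le, hα, Real.rpow_natCast] at h2
    calc 1 / d ^ n = d ^ 2 * (d ^ (n + 2))⁻¹ := by rw [pow_add]; field_simp
      _ ≤ d ^ 2 * δ 0 ^ α := mul_le_mul_of_nonneg_left h2 (by positivity)
  refine (abs_add_le _ _).trans ((add_le_add hhead htail).trans ?_)
  calc E / Λ / d ^ n + 2 * A / d ^ n = (E / Λ + 2 * A) * (1 / d ^ n) := by ring
    _ ≤ (E / Λ + 2 * A) * (d ^ 2 * δ 0 ^ α) := mul_le_mul_of_nonneg_left hdn (by positivity)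
    _ = _ := by ring

/-! ### Hölder continuity of the Green function -/

theorem exists_lift_bounds (k d : ℕ) (hd : 1 ≤ d) :
    ∃ B : ℝ, 1 ≤ B ∧ ∀ (K : Type u) [NormedField K] [IsAlgClosed K]
      (F : Fin (k + 1) → MvPolynomial (Fin (k + 1)) K)
      (f : ℙ K (Fin (k + 1) → K) → ℙ K (Fin (k + 1) → K)), IsLift d F f →
      resultant d F ≠ 0 ∧ 0 < coeffNorm norm d F ∧ 0 < resRatio norm d F ∧
      (∀ x, coeffNorm norm d F / (B * resRatio norm d F) * ‖x‖ ^ d ≤ ‖evalMap F x‖) ∧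
      (IsUltrametricDist K →
        ∀ x, coeffNorm norm d F / resRatio norm d F * ‖x‖ ^ d ≤ ‖evalMap F x‖) := by
  obtain ⟨B, hB1, hB⟩ := exists_norm_resultant_le.{u} k d hd
  refine ⟨B, hB1, fun K _ _ F f hF => ?_⟩
  have hB0 : 0 < B := by linarith
  have hzero : ∀ x, (∀ i, eval x (F i) = 0) → x = 0 := by
    intro x hx
    by_contra h
    obtain ⟨h1, -⟩ := hF.map_mk x h
    exact h1 (funext hx)
  have hres : resultant d F ≠ 0 := resultant_ne_zero hd hF.homogeneous hzero
  have hpos : 0 < coeffNorm norm d F := by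
    refine (coeffNorm_nonneg F).lt_of_ne' fun h => ?_
    have hone : (1 : Fin (k + 1) → K) ≠ 0 := one_ne_zero
    obtain ⟨h1, -⟩ := hF.map_mk 1 hone
    have h2 := (norm_evalMap_le hF.homogeneous (1 : Fin (k + 1) → K)).1
    rw [h, mul_zero, zero_mul] at h2
    exact h1 (norm_le_zero_iff.1 h2)
  have hres' : 0 < ‖resultant d F‖ := norm_pos_iff.2 hres
  have hM : 0 < resRatio norm d F := div_pos (pow_pos hpos _) hres'
  have key : ∀ (C : ℝ) (x : Fin (k + 1) → K), 0 < C →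
      coeffNorm norm d F * ‖resultant d F‖ * ‖x‖ ^ d ≤
        C * coeffNorm norm d F ^ ((k + 1) * d ^ k) * ‖evalMap F x‖ →
      coeffNorm norm d F / (C * resRatio norm d F) * ‖x‖ ^ d ≤ ‖evalMap F x‖ := by
    intro C x hC h
    have h1 : coeffNorm norm d F / (C * resRatio norm d F) * ‖x‖ ^ d =
        coeffNorm norm d F * ‖resultant d F‖ * ‖x‖ ^ d /
          (C * coeffNorm norm d F ^ ((k + 1) * d ^ k)) := by
      rw [resRatio]
      field_simp
    rw [h1, div_le_iff₀ (by positivity)]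
    linarith
  refine ⟨hres, hpos, hM, fun x => key B x hB0 (hB K F hF.homogeneous hpos x).1, fun hu x => ?_⟩
  have := key 1 x one_pos (by rw [one_mul]; exact (hB K F hF.homogeneous hpos x).2 hu)
  rwa [one_mul] at this

theorem log_le_posLog (x : ℝ) : log x ≤ log⁺ x := le_max_right _ _

theorem div_mul_log_le_posLog {d : ℕ} (hd : 1 ≤ d) (M : ℝ) : 1 / d * log M ≤ log⁺ M := by
  have h1 : (1 : ℝ) / d ≤ 1 := by
    rw [div_le_one (by exact_mod_cast hd)]
    exact_mod_cast hd
  exact (mul_le_mul_of_nonneg_left (log_le_posLog M) (by positivity)).trans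
    (mul_le_of_le_one_left posLog_nonneg h1)

theorem rpow_log_div_log {d Λ : ℝ} (hd : 0 < d) (hΛ : 1 < Λ) : Λ ^ (log d / log Λ) = d := by
  rw [Real.rpow_def_of_pos (by linarith), mul_div_cancel₀ _ (Real.log_pos hΛ).ne',
    Real.exp_log hd]

section Holder

variable {K : Type*} [NormedField K] {k d : ℕ} {F : Fin (k + 1) → MvPolynomial (Fin (k + 1)) K}
  {f : ℙ K (Fin (k + 1) → K) → ℙ K (Fin (k + 1) → K)} {B M : ℝ}

theorem archExponent_pos {C : ℝ} (hd : 2 ≤ d) (hC : 0 ≤ C) : 0 < archExponent d C M := by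
  have hd' : (2 : ℝ) ≤ d := by exact_mod_cast hd
  have h1 : 0 < log (max (2 * d) M) := Real.log_pos (by
    have := le_max_left (2 * (d : ℝ)) M
    linarith)
  exact div_pos (Real.log_pos (by linarith)) (by linarith)

/-- Valid over every normed field. The oscillation of `u_F` involves only the ratio of the upper and
lower bounds, in which `‖F‖` cancels; the term `log⁺ ‖F‖` is slack. -/
theorem abs_green_sub_le (hd : 2 ≤ d) (hF : IsLift d F f) (hB : 1 ≤ B) (hM : 0 < M)
    (hpos : 0 < coeffNorm norm d F)
    (hlow : ∀ x, coeffNorm norm d F / (B * M) * ‖x‖ ^ d ≤ ‖evalMap F x‖)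
    (z w : ℙ K (Fin (k + 1) → K)) :
    |green d F f z - green d F f w| ≤
      2 * d ^ 2 * (exp 1 + log (Fintype.card (Mon k d) * B) + log⁺ (coeffNorm norm d F) + log⁺ M) *
        chordalDist z w ^
          archExponent d (4 + 2 ^ (d + 1) * (Fintype.card (Mon k d) * d * B)) M := by
  have hd' : (2 : ℝ) ≤ d := by exact_mod_cast hd
  have hT : (1 : ℝ) ≤ Fintype.card (Mon k d) := by
    have : Nonempty (Mon k d) := ⟨⟨_, single_mem_mon d 0⟩⟩
    exact_mod_cast Fintype.card_pos
  set T : ℝ := (Fintype.card (Mon k d) : ℝ)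
  set κ : ℝ := 4 + 2 ^ (d + 1) * (T * d * B) with hκ
  set Φ := coeffNorm norm d F
  have ha : 0 < Φ / (B * M) := by positivity
  -- Both Lipschitz constants are at most `κ max {2d, M}`. Replacing `κ` by `exp κ` makes `log Λ`
  -- the denominator of the exponent, and the maximum ensures `2d ≤ Λ`.
  set Λ := exp κ * max (2 * (d : ℝ)) M with hΛ
  have hmax : 2 * (d : ℝ) ≤ max (2 * (d : ℝ)) M := le_max_left _ _
  have hmax' : M ≤ max (2 * (d : ℝ)) M := le_max_right _ _
  have hκ0 : 0 ≤ 2 ^ (d + 1) * (T * d * B) := by positivity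
  have hκe : κ ≤ exp κ := by linarith [Real.add_one_le_exp κ]
  have hquot : T * d * Φ / (Φ / (B * M)) = T * d * B * M := by field_simp
  have hΛκ : 4 + 2 ^ (d + 1) * (T * d * Φ / (Φ / (B * M))) ≤ Λ := by
    rw [hquot]
    calc 4 + 2 ^ (d + 1) * (T * d * B * M) = 4 * 1 + 2 ^ (d + 1) * (T * d * B) * M := by ring
      _ ≤ 4 * max (2 * (d : ℝ)) M + 2 ^ (d + 1) * (T * d * B) * max (2 * (d : ℝ)) M := by
        gcongr
        linarith
      _ = κ * max (2 * (d : ℝ)) M := by rw [hκ]; ring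
      _ ≤ Λ := mul_le_mul_of_nonneg_right hκe (by linarith)
  have hq0 : 0 ≤ T * d * Φ / (Φ / (B * M)) := by positivity
  have hΛ4 : 4 ≤ Λ := by
    have : 0 ≤ 2 ^ (d + 1) * (T * d * Φ / (Φ / (B * M))) := by positivity
    linarith
  have hΛd : 2 * (d : ℝ) ≤ Λ := by
    have h1 : 1 ≤ exp κ := Real.one_le_exp (by linarith)
    exact hmax.trans (le_mul_of_one_le_left (by linarith) h1)
  have hΛα : Λ ^ archExponent d κ M = d := by
    have : archExponent d κ M = log d / log Λ := by
      rw [hΛ, Real.log_mul (exp_pos _).ne' (by linarith), Real.log_exp]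
      rfl
    rw [this]
    exact rpow_log_div_log (by linarith) (by linarith)
  have hlip : ∀ x y : Fin (k + 1) → K, ‖x‖ ≤ 1 → ‖y‖ ≤ 1 →
      ‖evalMap F x - evalMap F y‖ ≤ T * d * Φ * ‖x - y‖ := fun x y hx hy =>
    (norm_evalMap_sub_le hF.homogeneous hx hy).1
  have hup : ∀ x, ‖evalMap F x‖ ≤ T * Φ * ‖x‖ ^ d := fun x =>
    (norm_evalMap_le hF.homogeneous x).1
  have hstep := step_of_normed (by omega) hF ha hlow hlip (by positivity)
  have hA : 1 / d * (log (T * Φ) - log (Φ / (B * M))) ≤ log (T * B) + log⁺ M := by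
    have h1 : log (T * Φ) - log (Φ / (B * M)) = log (T * B) + log M := by
      rw [← Real.log_div (by positivity) (by positivity), ← Real.log_mul (by positivity) hM.ne']
      congr 1
      field_simp
    rw [h1, mul_add]
    have h2 : 0 ≤ log (T * B) := Real.log_nonneg (one_le_mul_of_one_le_of_one_le hT hB)
    have h3 : (1 : ℝ) / d ≤ 1 := by
      rw [div_le_one (by linarith)]
      linarith
    exact add_le_add (mul_le_of_le_one_left h2 h3) (div_mul_log_le_posLog (by omega) M)
  have h := abs_tsum_sub_tsum_le (E := Λ) (A := log (T * B) + log⁺ M)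
    (u := fun j => potential d F (f^[j] z)) (v := fun j => potential d F (f^[j] w))
    (δ := fun j => chordalDist (f^[j] z) (f^[j] w)) hd' (by linarith) (by linarith) (Or.inr hΛd) hΛα
    (fun j => (abs_potential_sub_le (by omega) hF ha hlow hup _ _).trans hA)
    (fun j => chordalDist_nonneg _ _) (fun j => ?_) (fun j hj => ?_)
    (summable_potential hd hF ha hlow hup z) (summable_potential hd hF ha hlow hup w)
  · refine h.trans (mul_le_mul_of_nonneg_right ?_ (Real.rpow_nonneg (chordalDist_nonneg _ _) _))
    rw [div_self (by linarith)]
    have h1 : 1 + 2 * (log (T * B) + log⁺ M) ≤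
        2 * (exp 1 + log (T * B) + log⁺ Φ + log⁺ M) := by
      have h2 : 0 ≤ log⁺ Φ := posLog_nonneg
      have h3 : 1 ≤ exp 1 := Real.one_le_exp zero_le_one
      linarith
    calc (1 + 2 * (log (T * B) + log⁺ M)) * (d : ℝ) ^ 2
        ≤ 2 * (exp 1 + log (T * B) + log⁺ Φ + log⁺ M) * (d : ℝ) ^ 2 :=
          mul_le_mul_of_nonneg_right h1 (by positivity)
      _ = _ := by ring
  · simp only [Function.iterate_succ_apply']
    exact (hstep _ _).1.trans (mul_le_mul_of_nonneg_right hΛκ (chordalDist_nonneg _ _))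
  · have h1 : chordalDist (f^[j] z) (f^[j] w) ≤ 1 / 2 := by
      refine hj.le.trans ?_
      rw [one_div]
      exact inv_anti₀ (by norm_num) (by nlinarith)
    refine ((hstep _ _).2 h1).trans (mul_le_mul_of_nonneg_right ?_ (chordalDist_nonneg _ _))
    refine le_trans ?_ hΛκ
    have : (2 : ℝ) ^ d ≤ 2 ^ (d + 1) := pow_le_pow_right₀ (by norm_num) (by omega)
    gcongr
    norm_num

theorem abs_green_sub_le_of_ultrametric [IsUltrametricDist K] (hd : 2 ≤ d) (hF : IsLift d F f)
    (hM : 0 < M) (hpos : 0 < coeffNorm norm d F)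
    (hlow : ∀ x, coeffNorm norm d F / M * ‖x‖ ^ d ≤ ‖evalMap F x‖) :
    1 ≤ M ∧ ∀ z w : ℙ K (Fin (k + 1) → K), |green d F f z - green d F f w| ≤
      2 * d ^ 2 * log⁺ M * chordalDist z w ^ nonarchExponent d 1 M := by
  have hd' : (2 : ℝ) ≤ d := by exact_mod_cast hd
  set Φ := coeffNorm norm d F
  have ha : 0 < Φ / M := by positivity
  have hlip : ∀ x y : Fin (k + 1) → K, ‖x‖ ≤ 1 → ‖y‖ ≤ 1 →
      ‖evalMap F x - evalMap F y‖ ≤ Φ * ‖x - y‖ := fun x y hx hy =>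
    (norm_evalMap_sub_le hF.homogeneous hx hy).2 inferInstance
  have hup : ∀ x, ‖evalMap F x‖ ≤ Φ * ‖x‖ ^ d := fun x =>
    (norm_evalMap_le hF.homogeneous x).2 inferInstance
  have haΦ : Φ / M ≤ Φ := by
    have := (hlow 1).trans (hup 1)
    simpa using this
  -- The upper and lower bounds are compared at `(1, …, 1)`, a vector of norm `1`.
  have hM1 : 1 ≤ M := by
    rw [div_le_iff₀ hM] at haΦ
    exact (le_mul_iff_one_le_right hpos).1 haΦ
  refine ⟨hM1, fun z w => ?_⟩
  have hstep := step_of_ultrametric (by omega) hF ha hlow hlip haΦ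
  have hquot : Φ / (Φ / M) = M := by field_simp
  have hquot' : Φ / M / Φ = M⁻¹ := by field_simp
  rw [hquot, hquot'] at hstep
  have hA : 1 / d * (log Φ - log (Φ / M)) ≤ log⁺ M := by
    have h1 : log Φ - log (Φ / M) = log M := by
      rw [Real.log_div hpos.ne' hM.ne']
      ring
    rw [h1]
    exact div_mul_log_le_posLog (by omega) M
  -- For `M = 1` distances do not grow and any `Λ > 1` is admissible; `Λ = d` yields exponent `1`.
  obtain ⟨Λ, hΛ1, hMΛ, hΛα⟩ : ∃ Λ : ℝ, 1 < Λ ∧ M ≤ Λ ∧ Λ ^ nonarchExponent d 1 M = d := by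
    by_cases h : M = 1
    · refine ⟨d, by linarith, by linarith, ?_⟩
      rw [nonarchExponent, if_pos h, Real.rpow_one]
    · have hM1' : 1 < M := lt_of_le_of_ne hM1 (Ne.symm h)
      refine ⟨M, hM1', le_rfl, ?_⟩
      rw [nonarchExponent, if_neg h, one_mul]
      exact rpow_log_div_log (by linarith) hM1'
  have h := abs_tsum_sub_tsum_le (E := 0) (A := log⁺ M)
    (u := fun j => potential d F (f^[j] z)) (v := fun j => potential d F (f^[j] w))
    (δ := fun j => chordalDist (f^[j] z) (f^[j] w)) hd' hΛ1 le_rfl (Or.inl rfl) hΛα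
    (fun j => (abs_potential_sub_le (by omega) hF ha hlow hup _ _).trans hA)
    (fun j => chordalDist_nonneg _ _) (fun j => ?_) (fun j hj => ?_)
    (summable_potential hd hF ha hlow hup z) (summable_potential hd hF ha hlow hup w)
  · refine h.trans (le_of_eq ?_)
    simp only [Function.iterate_zero, id]
    ring
  · simp only [Function.iterate_succ_apply']
    exact (hstep _ _).1.trans (mul_le_mul_of_nonneg_right hMΛ (chordalDist_nonneg _ _))
  · have h1 : chordalDist (f^[j] z) (f^[j] w) < M⁻¹ :=
      hj.trans_le (inv_anti₀ hM (by nlinarith))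
    simp [(hstep _ _).2 h1]

theorem nonarchExponent_pos {c : ℝ} (hd : 2 ≤ d) (hc : 0 < c) (hM : 1 ≤ M) :
    0 < nonarchExponent d c M := by
  have hd' : (2 : ℝ) ≤ d := by exact_mod_cast hd
  rw [nonarchExponent]
  split_ifs with h
  · exact one_pos
  · have hM1' : 1 < M := lt_of_le_of_ne hM (Ne.symm h)
    exact div_pos (Real.log_pos (by linarith)) (mul_pos hc (Real.log_pos hM1'))

theorem nonarchExponent_two_le (hd : 2 ≤ d) (hM : 1 ≤ M) :
    nonarchExponent d 2 M ≤ nonarchExponent d 1 M := by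
  have hd' : (2 : ℝ) ≤ d := by exact_mod_cast hd
  rw [nonarchExponent, nonarchExponent]
  split_ifs with h
  · exact le_rfl
  · have hM1' : 1 < M := lt_of_le_of_ne hM (Ne.symm h)
    have h1 := Real.log_pos hM1'
    exact div_le_div_of_nonneg_left (Real.log_nonneg (by linarith)) (by linarith) (by linarith)

end Holder

/-! ### Change of field -/

theorem resultant_map {R S : Type*} [CommRing R] [CommRing S] (φ : R →+* S) {k : ℕ} (d : ℕ)
    (F : Fin (k + 1) → MvPolynomial (Fin (k + 1)) R) :
    resultant d (fun i => (F i).map φ) = φ (resultant d F) := by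
  have h := ringHom_eq_aeval (φ.comp (aeval (fun p : Fin (k + 1) × (Fin (k + 1) →₀ ℕ) =>
    (F p.1).coeff p.2) : CoeffRing k →ₐ[ℤ] R).toRingHom) (universalResultant k d)
  refine Eq.trans ?_ h.symm
  unfold resultant evalCoeffs
  congr 2
  ext1 p
  simp [coeff_map]

section Extension

variable {L K : Type*} [Field L] [NormedField K] [Algebra L K] {v : AbsoluteValue L ℝ}
  {k : ℕ} (d : ℕ)
  (F : Fin (k + 1) → MvPolynomial (Fin (k + 1)) L)

theorem coeffNorm_map (hv : ∀ a : L, ‖algebraMap L K a‖ = v a) :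
    coeffNorm norm d (fun i => (F i).map (algebraMap L K)) = coeffNorm v d F := by
  simp only [coeffNorm, coeff_map, hv]

theorem resRatio_map (hv : ∀ a : L, ‖algebraMap L K a‖ = v a) :
    resRatio norm d (fun i => (F i).map (algebraMap L K)) = resRatio v d F := by
  rw [resRatio, resRatio, coeffNorm_map d F hv, resultant_map, hv]

/-- A norm is ultrametric as soon as it is at most `1` on the natural numbers, and these already lie
in `L`. -/
theorem isUltrametricDist_iff_isNonarchimedean (hv : ∀ a : L, ‖algebraMap L K a‖ = v a) :
    IsUltrametricDist K ↔ IsNonarchimedean v := by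
  constructor
  · intro _ a b
    rw [← hv, ← hv, ← hv, map_add]
    exact IsUltrametricDist.norm_add_le_max _ _
  · intro h
    apply IsUltrametricDist.isUltrametricDist_of_forall_norm_natCast_le_one
    intro n
    rw [← map_natCast (algebraMap L K), hv]
    exact h.apply_natCast_le_one

end Extension

end GreenHolder

end

theorem theorem3p1 (k d : ℕ) (hk : 1 ≤ k) (hd : 2 ≤ d) :
    ∃ C₁ C₂ C₃ : ℝ, exp 1 ≤ C₁ ∧ exp 1 ≤ C₂ ∧ 1 ≤ C₃ ∧
      -- local statement, over an arbitrary complete algebraically closed field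
      (∀ (K : Type u) [NontriviallyNormedField K] [CompleteSpace K] [IsAlgClosed K] [CharZero K]
        (F : Fin (k + 1) → MvPolynomial (Fin (k + 1)) K)
        (f : ℙ K (Fin (k + 1) → K) → ℙ K (Fin (k + 1) → K)),
        IsLift d F f →
          resultant d F ≠ 0 ∧
          (∀ z, Summable fun j : ℕ => potential d F (f^[j] z) / (d : ℝ) ^ j) ∧
          (¬ IsUltrametricDist K →
            0 < archExponent d C₂ (resRatio norm d F) ∧
            ∀ z w, |green d F f z - green d F f w| ≤
              C₃ * (C₁ + log⁺ (coeffNorm norm d F) + log⁺ (resRatio norm d F)) *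
                chordalDist z w ^ archExponent d C₂ (resRatio norm d F)) ∧
          (IsUltrametricDist K →
            0 < nonarchExponent d 1 (resRatio norm d F) ∧
            ∀ z w, |green d F f z - green d F f w| ≤
              C₃ * (log⁺ (coeffNorm norm d F) + log⁺ (resRatio norm d F)) *
                chordalDist z w ^ nonarchExponent d 1 (resRatio norm d F))) ∧
      -- adelic statement: `𝕂` is a number field, `|·|_v` a nontrivial absolute value on `𝕂`,
      -- and `K` is a complete algebraically closed extension of `(𝕂, |·|_v)`, such as `ℂ_v`
      (∀ (𝕂 : Type v) [Field 𝕂] [NumberField 𝕂]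
        (F : Fin (k + 1) → MvPolynomial (Fin (k + 1)) 𝕂)
        (v : AbsoluteValue 𝕂 ℝ) (_ : v.IsNontrivial)
        (K : Type u) [NontriviallyNormedField K] [CompleteSpace K] [IsAlgClosed K] [Algebra 𝕂 K]
        (_ : ∀ a : 𝕂, ‖algebraMap 𝕂 K a‖ = v a)
        (f : ℙ K (Fin (k + 1) → K) → ℙ K (Fin (k + 1) → K)),
        IsLift d (fun i => (F i).map (algebraMap 𝕂 K)) f →
          (¬ IsNonarchimedean v →
            ∀ z w, |green d (fun i => (F i).map (algebraMap 𝕂 K)) f z -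
                green d (fun i => (F i).map (algebraMap 𝕂 K)) f w| ≤
              C₃ * (C₁ + log⁺ (coeffNorm v d F) + log⁺ (resRatio v d F)) *
                chordalDist z w ^ archExponent d C₂ (resRatio v d F)) ∧
          (IsNonarchimedean v →
            ∀ z w, |green d (fun i => (F i).map (algebraMap 𝕂 K)) f z -
                green d (fun i => (F i).map (algebraMap 𝕂 K)) f w| ≤
              C₃ * (1 + log⁺ (coeffNorm v d F) + log⁺ (resRatio v d F)) *
                chordalDist z w ^ nonarchExponent d 2 (resRatio v d F))) := by
  obtain ⟨B, hB, h⟩ := exists_lift_bounds.{u} k d (by omega)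
  have hd' : (2 : ℝ) ≤ d := by exact_mod_cast hd
  have hT : (1 : ℝ) ≤ Fintype.card (Mon k d) := by
    have : Nonempty (Mon k d) := ⟨⟨_, single_mem_mon d 0⟩⟩
    exact_mod_cast Fintype.card_pos
  have hlog : 0 ≤ log (Fintype.card (Mon k d) * B) :=
    Real.log_nonneg (one_le_mul_of_one_le_of_one_le hT hB)
  have hC : 0 ≤ 2 ^ (d + 1) * (Fintype.card (Mon k d) * d * B) := by positivity
  have hC₃ : (1 : ℝ) ≤ 2 * d ^ 2 := by nlinarith
  refine ⟨exp 1 + log (Fintype.card (Mon k d) * B),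
    4 + 2 ^ (d + 1) * (Fintype.card (Mon k d) * d * B), 2 * d ^ 2, by linarith,
    by linarith [Real.exp_one_lt_three], hC₃, ?_, ?_⟩
  · intro K _ _ _ _ F f hF
    obtain ⟨hres, hpos, hM, hlow, hlow'⟩ := h K F f hF
    refine ⟨hres, summable_potential hd hF (by positivity) hlow
      fun x => (norm_evalMap_le hF.homogeneous x).1, fun _ => ⟨archExponent_pos hd (by linarith),
      abs_green_sub_le hd hF hB hM hpos hlow⟩, fun hK => ?_⟩
    obtain ⟨hM1, hgreen⟩ := abs_green_sub_le_of_ultrametric hd hF hM hpos (hlow' hK)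
    refine ⟨nonarchExponent_pos hd one_pos hM1, fun z w => (hgreen z w).trans ?_⟩
    have := posLog_nonneg (x := coeffNorm norm d F)
    exact mul_le_mul_of_nonneg_right (mul_le_mul_of_nonneg_left (by linarith) (by linarith))
      (Real.rpow_nonneg (chordalDist_nonneg _ _) _)
  · intro 𝕂 _ _ F v _ K _ _ _ _ hv f hF
    obtain ⟨-, hpos, hM, hlow, hlow'⟩ := h K _ f hF
    rw [← coeffNorm_map d F hv, ← resRatio_map d F hv,
      ← isUltrametricDist_iff_isNonarchimedean hv]
    refine ⟨fun _ => abs_green_sub_le hd hF hB hM hpos hlow, fun hK z w => ?_⟩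
    obtain ⟨hM1, hgreen⟩ := abs_green_sub_le_of_ultrametric hd hF hM hpos (hlow' hK)
    have := posLog_nonneg (x := coeffNorm norm d fun i => (F i).map (algebraMap 𝕂 K))
    have hδ := chordalDist_nonneg z w
    have hlogM := posLog_nonneg (x := resRatio norm d fun i => (F i).map (algebraMap 𝕂 K))
    -- The factor `2` in the adelic exponent only weakens the local bound, since ultrametric chordal
    -- distances are at most `1`.
    exact (hgreen z w).trans (mul_le_mul (mul_le_mul_of_nonneg_left (by linarith) (by linarith))
      (Real.rpow_le_rpow_of_exponent_ge' hδ (chordalDist_le_one z w)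
        (nonarchExponent_pos hd two_pos hM1).le (nonarchExponent_two_le hd hM1))
      (Real.rpow_nonneg hδ _) (by positivity))
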